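/- **Coarse spaces.** For subsets $E,F$ of $X\times X$ put $E\circ F=\{(x,y): \exists z,\ (x,z)\in E,\ (z,y)\in F\}$, $E^{-1}=\{(x,y):(y,x)\in E\}$ and $E^{\circ n}=E\circ\cdots\circ E$ ($n\ge 1$ factors). A coarse structure on a set $X$ is a family of subsets of $X\times X$, called controlled sets, that contains the diagonal and is closed under taking subsets, finite unions, compositions and inverses. It has *bounded geometry* if for each controlled $E$ there is $M$ with $|\{y:(x,y)\in E\cup E^{-1}\}|\le M$ for all $x\in X$. A controlled set $E$ is *generating* if each controlled set is contained in $E^{\circ n}$ for some $n\geq 1$, and the coarse structure is *monogenic* if a generating controlled set exists. The *coarse components* are the classes of the equivalence relation "$\{(x,y)\}$ is controlled". A *space* is a set with a monogenic coarse structure of bounded geometry that has at most countably many coarse components. **Coarse equivalence.** A map $f:X\to Y$ between spaces is uniformly expansive if $\{(f(x_1),f(x_2)):(x_1,x_2)\in E\}$ is controlled for each controlled $E\subseteq X\times X$; maps $f,g:X\to Y$ are close if $\{(f(x),g(x)):x\in X\}$ is controlled. $X$ and $Y$ are *coarsely equivalent* if there are uniformly expansive maps $f:X\to Y$ and $g:Y\to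 X$ with $f\circ g$ and $g\circ f$ close to the identity maps of $Y$ and $X$. **Geometric property (T).** The translation algebra $\mathbb{C}_u[X]$ is the $*$-algebra (under matrix operations) of complex matrices $T=(T_{xy})_{x,y\in X}$ with $\sup_{x,y}|T_{xy}|<\infty$ and with controlled support $\{(x,y):T_{xy}\ne 0\}$. A partial translation is a bijection $t:A\to B$ between subsets of $X$ such that $\{(t(a),a):a\in A\}$ is controlled; it is identified with the element $v\in\mathbb{C}_u[X]$ with $v_{xy}=1$ if $y\in A$ and $t(y)=x$, and $v_{xy}=0$ otherwise. A representation is a unital $*$-homomorphism from $\mathbb{C}_u[X]$ to the bounded operators on a complex Hilbert space $\mathcal{H}$; $\mathcal{H}_c\subseteq\mathcal{H}$ denotes the subspace of all $\xi$ with $v\xi=vv^*\xi$ for all partial translations $v$. The space $X$ has *geometric property (T)* if for each controlled generating set $E$ there is $c>0$ such that for each representation $\mathcal{H}$ and each $\xi\in\mathcal{H}_c^\perp$ there is a partial translation $v\in\mathbb{C}_u[X]$ with support in $E$ and $\|(vv^*-v)\xi\|\ge c\|\xi\|$. **Theorem.** Let $X$ and $Y$ be coarsely equivalent spaces. Then $X$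 has geometric property (T) if and only if $Y$ does. -/

import Mathlib

universe u v w

noncomputable section

namespace CoarseGeometry

/-! ### Coarse spaces -/

/-- A coarse structure on `X`: a family of controlled subsets of `X × X` which contains the diagonal
and is closed under subsets, finite unions, compositions and inverses. -/
class CoarseSpace (X : Type u) where
  /-- The controlled sets (entourages). -/
  IsControlled : SetRel X X → Prop
  diagonal : IsControlled SetRel.id
  subset : ∀ {E F : SetRel X X}, IsControlled E → F ⊆ E → IsControlled F
  union : ∀ {E F : SetRel X X}, IsControlled E → IsControlled F → IsControlled (E ∪ F)
  comp : ∀ {E F : SetRel X X}, IsControlled E → IsControlled F → IsControlled (E.comp F)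
  inv : ∀ {E : SetRel X X}, IsControlled E → IsControlled E.inv

/-- `relPow E n` is the `n`-fold composition `E ∘ ⋯ ∘ E` (the diagonal for `n = 0`). -/
def relPow {X : Type u} (E : SetRel X X) : ℕ → SetRel X X
  | 0 => SetRel.id
  | n + 1 => E.comp (relPow E n)

section Space

variable (X : Type u) [CoarseSpace X]

/-- Bounded geometry: for each controlled set `E` there is a bound `M` on the number of points
`y` with `(x, y) ∈ E ∪ E⁻¹`, uniform in `x`. -/
class BoundedGeometry : Prop where
  exists_bound : ∀ E : SetRel X X, CoarseSpace.IsControlled E →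
    ∃ M : ℕ, ∀ x : X, {y | (x, y) ∈ E ∪ E.inv}.encard ≤ M

variable {X} in
/-- A controlled set `E` is generating if each controlled set lies in some `E ∘ ⋯ ∘ E`
(with at least one factor). -/
def IsGenerating (E : SetRel X X) : Prop :=
  CoarseSpace.IsControlled E ∧
    ∀ F : SetRel X X, CoarseSpace.IsControlled F → ∃ n : ℕ, 1 ≤ n ∧ F ⊆ relPow E n

/-- A coarse space is monogenic if it has a generating controlled set. -/
class Monogenic : Prop where
  exists_generating : ∃ E : SetRel X X, IsGenerating E

/-- Two points `x`, `y` are in the same coarse component if `{(x, y)}` is controlled. -/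
def componentSetoid : Setoid X where
  r x y := CoarseSpace.IsControlled ({(x, y)} : SetRel X X)
  iseqv :=
    { refl := fun x => CoarseSpace.subset CoarseSpace.diagonal (by simp)
      symm := fun {x y} h => CoarseSpace.subset (CoarseSpace.inv h) (by simp)
      trans := fun {x y z} h h' => CoarseSpace.subset (CoarseSpace.comp h h') (by simp) }

/-- The set of coarse components. -/
abbrev CoarseComponent : Type u := Quotient (componentSetoid X)

/-- There are at most countably many coarse components. -/
class CountablyManyComponents : Prop where
  countable : Countable (CoarseComponent X)

end Space

/-! ### Coarse equivalence -/

section Equivalence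

variable {X : Type u} {Y : Type v} [CoarseSpace X] [CoarseSpace Y]

/-- Images of controlled sets are controlled. -/
def UniformlyExpansive (f : X → Y) : Prop :=
  ∀ E : SetRel X X, CoarseSpace.IsControlled E →
    CoarseSpace.IsControlled ({p | ∃ x₁ x₂, (x₁, x₂) ∈ E ∧ p = (f x₁, f x₂)} : SetRel Y Y)

/-- Two maps are close if `{(f x, g x)}` is controlled. -/
def Close (f g : X → Y) : Prop :=
  CoarseSpace.IsControlled ({p | ∃ x, p = (f x, g x)} : SetRel Y Y)

variable (X Y) in
/-- Coarse equivalence of coarse spaces. -/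
def CoarselyEquivalent : Prop :=
  ∃ (f : X → Y) (g : Y → X), UniformlyExpansive f ∧ UniformlyExpansive g ∧
    Close (f ∘ g) id ∧ Close (g ∘ f) id

end Equivalence

/-! ### The translation algebra -/

/-- The support of a matrix. -/
def matrixSupport {X : Type u} (T : Matrix X X ℂ) : SetRel X X := {p | T p.1 p.2 ≠ 0}

section Algebra

variable (X : Type u) [CoarseSpace X]

/-- The vector space of matrices with uniformly bounded entries and controlled support. -/
def translationSubmodule : Submodule ℂ (Matrix X X ℂ) where
  carrier := {T | (∃ C : ℝ, ∀ x y, ‖T x y‖ ≤ C) ∧ CoarseSpace.IsControlled (matrixSupport T)}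
  zero_mem' := ⟨⟨0, by simp⟩,
    CoarseSpace.subset CoarseSpace.diagonal (by rintro ⟨x, y⟩ h; simp [matrixSupport] at h)⟩
  add_mem' := by
    rintro S T ⟨⟨C, hC⟩, hS⟩ ⟨⟨D, hD⟩, hT⟩
    refine ⟨⟨C + D, fun x y => (norm_add_le _ _).trans (add_le_add (hC x y) (hD x y))⟩,
      CoarseSpace.subset (CoarseSpace.union hS hT) ?_⟩
    rintro ⟨x, y⟩ h
    by_contra h'
    simp only [matrixSupport, Set.mem_union, Set.mem_ofPred_eq, not_or, not_not] at h h'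
    exact h (by simp [h'.1, h'.2])
  smul_mem' := by
    rintro c T ⟨⟨C, hC⟩, hT⟩
    refine ⟨⟨‖c‖ * C, fun x y => ?_⟩, CoarseSpace.subset hT ?_⟩
    · simpa using mul_le_mul_of_nonneg_left (hC x y) (norm_nonneg c)
    · rintro ⟨x, y⟩ h h'
      exact h (by simp [h'])

/-- The translation algebra `ℂ_u[X]`. -/
def TranslationAlgebra : Type u := translationSubmodule X

namespace TranslationAlgebra

instance : AddCommGroup (TranslationAlgebra X) :=
  inferInstanceAs (AddCommGroup (translationSubmodule X))

instance : Module ℂ (TranslationAlgebra X) :=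
  inferInstanceAs (Module ℂ (translationSubmodule X))

variable {X}

/-- The underlying matrix. -/
def entry (T : TranslationAlgebra X) : X → X → ℂ := Subtype.val T

/-- The support of an element of the translation algebra. -/
def supp (T : TranslationAlgebra X) : SetRel X X := matrixSupport T.entry

@[ext] theorem ext {S T : TranslationAlgebra X} (h : ∀ x y, S.entry x y = T.entry x y) : S = T :=
  Subtype.ext (Matrix.ext h)

theorem exists_bound (T : TranslationAlgebra X) : ∃ C : ℝ, ∀ x y, ‖T.entry x y‖ ≤ C :=
  T.2.1

theorem controlled_supp (T : TranslationAlgebra X) : CoarseSpace.IsControlled T.supp :=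
  T.2.2

@[simp] theorem entry_zero (x y : X) : (0 : TranslationAlgebra X).entry x y = 0 := rfl

@[simp] theorem entry_add (S T : TranslationAlgebra X) (x y : X) :
    (S + T).entry x y = S.entry x y + T.entry x y := rfl

@[simp] theorem entry_smul (c : ℂ) (T : TranslationAlgebra X) (x y : X) :
    (c • T).entry x y = c * T.entry x y := rfl

open Classical in
instance : One (TranslationAlgebra X) where
  one := ⟨1, ⟨1, fun x y => by by_cases h : x = y <;> simp [Matrix.one_apply, h]⟩,
    CoarseSpace.subset CoarseSpace.diagonal (by
      rintro ⟨x, y⟩ h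
      by_contra h'
      exact h (Matrix.one_apply_ne h'))⟩

open Classical in
theorem entry_one (x y : X) :
    (1 : TranslationAlgebra X).entry x y = if x = y then 1 else 0 := rfl

/-- The adjoint (conjugate transpose). -/
instance : Star (TranslationAlgebra X) where
  star T := ⟨fun x y => star (T.entry y x),
    T.exists_bound.imp fun C hC x y => by simpa using hC y x,
    CoarseSpace.subset (CoarseSpace.inv T.controlled_supp) (by
      rintro ⟨x, y⟩ h h'
      exact h (by simpa using h'))⟩

@[simp] theorem entry_star (T : TranslationAlgebra X) (x y : X) :
    (star T).entry x y = star (T.entry y x) := rfl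

theorem finsum_eq (S T : TranslationAlgebra X) (x y : X) (s : Finset X)
    (hs : ∀ z, S.entry x z ≠ 0 → z ∈ s) :
    ∑ᶠ z, S.entry x z * T.entry z y = ∑ z ∈ s, S.entry x z * T.entry z y :=
  finsum_eq_sum_of_support_subset _ fun z hz => hs z fun h => hz (by simp [h])

variable [BoundedGeometry X]

theorem exists_row (T : TranslationAlgebra X) :
    ∃ M : ℕ, ∀ x, ∃ s : Finset X, s.card ≤ M ∧ ∀ z, T.entry x z ≠ 0 → z ∈ s := by
  obtain ⟨M, hM⟩ := BoundedGeometry.exists_bound _ T.controlled_supp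
  refine ⟨M, fun x => ?_⟩
  have hfin := Set.finite_of_encard_le_coe (hM x)
  refine ⟨hfin.toFinset, ?_, fun z hz => ?_⟩
  · have := hM x
    rw [hfin.encard_eq_coe_toFinset_card] at this
    exact_mod_cast this
  · exact hfin.mem_toFinset.2 (Or.inl hz)

/-- Matrix multiplication; the sum over `z` has only finitely many non-zero terms. -/
instance : Mul (TranslationAlgebra X) where
  mul S T := ⟨fun x y => ∑ᶠ z, S.entry x z * T.entry z y, by
    obtain ⟨C, hC⟩ := S.exists_bound
    obtain ⟨D, hD⟩ := T.exists_bound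
    obtain ⟨M, hM⟩ := S.exists_row
    refine ⟨M * (C * D), fun x y => ?_⟩
    obtain ⟨s, hs, hs'⟩ := hM x
    have hC0 : 0 ≤ C := (norm_nonneg _).trans (hC x x)
    have hD0 : 0 ≤ D := (norm_nonneg _).trans (hD x x)
    change ‖∑ᶠ z, S.entry x z * T.entry z y‖ ≤ _
    rw [finsum_eq S T x y s hs']
    calc ‖∑ z ∈ s, S.entry x z * T.entry z y‖ ≤ ∑ z ∈ s, C * D :=
          norm_sum_le_of_le _ fun z _ => by
            rw [norm_mul]
            exact mul_le_mul (hC x z) (hD z y) (norm_nonneg _) hC0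
      _ = s.card * (C * D) := by simp
      _ ≤ M * (C * D) := by gcongr, by
    refine CoarseSpace.subset (CoarseSpace.comp S.controlled_supp T.controlled_supp) ?_
    rintro ⟨x, y⟩ h
    obtain ⟨z, hz⟩ : ∃ z, S.entry x z * T.entry z y ≠ 0 := by
      by_contra! h'
      exact h (by simp [h'])
    exact ⟨z, left_ne_zero_of_mul hz, right_ne_zero_of_mul hz⟩⟩

theorem entry_mul (S T : TranslationAlgebra X) (x y : X) :
    (S * T).entry x y = ∑ᶠ z, S.entry x z * T.entry z y := rfl

theorem entry_mul_eq_sum (S T : TranslationAlgebra X) (x y : X) (s : Finset X)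
    (hs : ∀ z, S.entry x z ≠ 0 → z ∈ s) :
    (S * T).entry x y = ∑ z ∈ s, S.entry x z * T.entry z y :=
  finsum_eq S T x y s hs

theorem exists_row_finset (T : TranslationAlgebra X) (x : X) :
    ∃ s : Finset X, ∀ z, T.entry x z ≠ 0 → z ∈ s := by
  obtain ⟨M, hM⟩ := T.exists_row
  obtain ⟨s, -, hs⟩ := hM x
  exact ⟨s, hs⟩

open Classical in
protected theorem mul_assoc' (S T U : TranslationAlgebra X) : S * T * U = S * (T * U) := by
  ext x y
  obtain ⟨s, hs⟩ := S.exists_row_finset x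
  choose t ht using T.exists_row_finset
  rw [entry_mul_eq_sum (S * T) U x y (s.biUnion t), entry_mul_eq_sum S _ x y s hs]
  · have h1 : ∀ z ∈ s, (T * U).entry z y = ∑ v ∈ s.biUnion t, T.entry z v * U.entry v y :=
      fun z hz => entry_mul_eq_sum T U z y _ fun v hv =>
        Finset.mem_biUnion.2 ⟨z, hz, ht z v hv⟩
    have h2 : ∀ z ∈ s, S.entry x z * (T * U).entry z y =
        ∑ v ∈ s.biUnion t, S.entry x z * T.entry z v * U.entry v y := fun z hz => by
      rw [h1 z hz, Finset.mul_sum]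
      simp_rw [mul_assoc]
    rw [Finset.sum_congr rfl h2, Finset.sum_comm]
    simp_rw [entry_mul_eq_sum S T x _ s hs, Finset.sum_mul]
  · intro v hv
    rw [entry_mul_eq_sum S T x v s hs] at hv
    obtain ⟨z, hz, hne⟩ := Finset.exists_ne_zero_of_sum_ne_zero hv
    exact Finset.mem_biUnion.2 ⟨z, hz, ht z v (right_ne_zero_of_mul hne)⟩

open Classical in
instance : Ring (TranslationAlgebra X) :=
  { (inferInstance : AddCommGroup (TranslationAlgebra X)),
    (inferInstance : Mul (TranslationAlgebra X)),
    (inferInstance : One (TranslationAlgebra X)) with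
    left_distrib := fun S T U => by
      ext x y
      obtain ⟨s, hs⟩ := S.exists_row_finset x
      simp [entry_mul_eq_sum S _ x y s hs, mul_add, Finset.sum_add_distrib]
    right_distrib := fun S T U => by
      ext x y
      obtain ⟨s, hs⟩ := S.exists_row_finset x
      obtain ⟨t, ht⟩ := T.exists_row_finset x
      obtain ⟨r, hr⟩ := (S + T).exists_row_finset x
      rw [entry_add,
        entry_mul_eq_sum S _ x y (s ∪ t ∪ r) fun z hz => by simp [hs z hz],
        entry_mul_eq_sum T _ x y (s ∪ t ∪ r) fun z hz => by simp [ht z hz],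
        entry_mul_eq_sum (S + T) _ x y (s ∪ t ∪ r) fun z hz => by simp [hr z hz]]
      simp [add_mul, Finset.sum_add_distrib]
    zero_mul := fun T => by
      ext x y
      simp [entry_mul]
    mul_zero := fun T => by
      ext x y
      simp [entry_mul]
    mul_assoc := TranslationAlgebra.mul_assoc'
    one_mul := fun T => by
      ext x y
      rw [entry_mul_eq_sum 1 T x y {x} fun z hz => by
        by_contra h
        exact hz (by rw [entry_one, if_neg fun h' => h (by simp [h'])])]
      simp [entry_one]
    mul_one := fun T => by
      ext x y
      rw [entry_mul, finsum_eq_single _ y fun z hz => by simp [entry_one, hz]]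
      simp [entry_one] }

instance : StarRing (TranslationAlgebra X) where
  star_involutive T := by ext x y; simp
  star_add S T := by ext x y; simp
  star_mul S T := by
    ext x y
    obtain ⟨s, hs⟩ := S.exists_row_finset y
    rw [entry_star, entry_mul_eq_sum S T y x s hs, entry_mul,
      finsum_eq_sum_of_support_subset (s := s)]
    · simp [mul_comm]
    · intro z hz
      exact hs z fun h => hz (by simp [h])

instance : Algebra ℂ (TranslationAlgebra X) :=
  Algebra.ofModule
    (fun c S T => by
      ext x y
      obtain ⟨s, hs⟩ := S.exists_row_finset x
      rw [entry_smul, entry_mul_eq_sum S T x y s hs,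
        entry_mul_eq_sum (c • S) T x y s fun z hz => hs z fun h => hz (by simp [h])]
      simp [Finset.mul_sum, mul_assoc])
    (fun c S T => by
      ext x y
      obtain ⟨s, hs⟩ := S.exists_row_finset x
      rw [entry_smul, entry_mul_eq_sum S T x y s hs, entry_mul_eq_sum S _ x y s hs]
      simp [Finset.mul_sum, mul_left_comm])

instance : StarModule ℂ (TranslationAlgebra X) where
  star_smul c T := by ext x y; simp

end TranslationAlgebra

end Algebra

/-! ### Partial translations -/

section PartialTranslation

variable (X : Type u) [CoarseSpace X]

/-- A partial translation: a bijection `t : A → B` between subsets of `X` (encoded as a `PEquiv`)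
whose graph `{(t a, a) : a ∈ A}` is controlled. -/
structure PartialTranslation where
  /-- The partial bijection. -/
  toPEquiv : X ≃. X
  controlled_graph :
    CoarseSpace.IsControlled ({p | toPEquiv p.2 = some p.1} : SetRel X X)

variable {X}

open Classical in
/-- The operator of a partial translation `t`: its `(x, y)` entry is `1` if `t y = x`, and `0`
otherwise. -/
def PartialTranslation.op (t : PartialTranslation X) : TranslationAlgebra X :=
  ⟨fun x y => if t.toPEquiv y = some x then 1 else 0,
    ⟨1, fun x y => by by_cases h : t.toPEquiv y = some x <;> simp [h]⟩,
    CoarseSpace.subset t.controlled_graph (by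
      rintro ⟨x, y⟩ h
      by_contra h'
      exact h (if_neg h'))⟩

end PartialTranslation

/-! ### Representations and geometric property (T) -/

section PropertyT

variable (X : Type u) [CoarseSpace X] [BoundedGeometry X]

/-- A representation of `ℂ_u[X]` on a Hilbert space `H`: a unital `*`-homomorphism into the bounded
operators on `H`. -/
abbrev Representation (H : Type w) [NormedAddCommGroup H] [InnerProductSpace ℂ H]
    [CompleteSpace H] : Type (max u w) :=
  TranslationAlgebra X →⋆ₐ[ℂ] (H →L[ℂ] H)

variable {X} in
/-- The subspace of constant (invariant) vectors: those `ξ` with `v ξ = v v* ξ` for all partial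
translations `v`. -/
def constantVectors {H : Type w} [NormedAddCommGroup H] [InnerProductSpace ℂ H]
    [CompleteSpace H] (π : Representation X H) : Submodule ℂ H where
  carrier := {ξ | ∀ t : PartialTranslation X, π t.op ξ = π (t.op * star t.op) ξ}
  zero_mem' := fun t => by simp
  add_mem' := fun {ξ η} hξ hη t => by rw [map_add, map_add, hξ t, hη t]
  smul_mem' := fun c ξ hξ t => by rw [map_smul, map_smul, hξ t]

/-- Geometric property (T): for each controlled generating set `E` there is `c > 0` such that for
each representation and each vector `ξ` orthogonal to the constant vectors there is a partial
translation `v` supported in `E` with `‖(v v* - v) ξ‖ ≥ c ‖ξ‖`. The representations range over all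
Hilbert spaces in an arbitrary fixed universe `w`. -/
def GeometricPropertyT : Prop :=
  ∀ E : SetRel X X, IsGenerating E → ∃ c : ℝ, 0 < c ∧
    ∀ (H : Type w) [NormedAddCommGroup H] [InnerProductSpace ℂ H] [CompleteSpace H]
      (π : Representation X H) (ξ : H), ξ ∈ (constantVectors π)ᗮ →
      ∃ t : PartialTranslation X, t.op.supp ⊆ E ∧
        c * ‖ξ‖ ≤ ‖π (t.op * star t.op - t.op) ξ‖

end PropertyT

end CoarseGeometry

end

/-!
By symmetry it suffices to transfer property (T) from `X` to `Y` along a coarse equivalence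
`f : X → Y` with coarse inverse `g`. Two ideas carry the proof.

**Row sums.** The operators `v v* - v` (`PartialTranslation.defect`) have vanishing row sums, and
the matrices with vanishing row sums form a left ideal. Conversely such a matrix `T` is a finite
sum `-∑ₖ Dₖ (vₖ vₖ* - vₖ)` with `Dₖ` diagonal (`TranslationAlgebra.exists_eq_sum_diag_mul_op`, by
an edge colouring of the support of `T`). Hence a vector is constant if and only if it is
annihilated by all matrices with vanishing row sums. Quantitatively, if `‖(v v* - v) ξ‖ ≤ δ` for
all `v` supported in a generating set, then `‖T ξ‖ ≤ κ δ` for every such `T`, where `κ` depends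
only on a controlled set containing the support of `T` and on a bound for its entries
(`IsGenerating.exists_norm_apply_le`):
partial translations supported in `E ∘ ⋯ ∘ E` are sums of boundedly many products of partial
translations in `E`.

**Induction.** The fibres of `f` are uniformly bounded, so `x ↦ (f x, c x)` embeds `X` into
finitely many copies of `Y`, while `Y` is embedded as the zeroth copy. A representation `ρ` of
`ℂ_u[Y]` on `K` extends to a representation of the translation algebra of the copies on a sum of
copies of `K` (`amplify`), and `ℂ_u[X]` acts unitally on a corner of this sum (`compress`).
Composition with `f` and with `g` become matrices `V` and `W` over the copies of `Y`.

Constant vectors of the corner are of the form `V ζ` with `ζ` constant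
(`exists_mem_constantVectors_pullOp`): take `ζ = W η`. If `T` has vanishing row sums then so has
`U = T W`, because the rows of `W` over `Y` sum to `1`, and `U* U` is a matrix over `X` with vanishing
row sums, whence `‖U η‖² = ⟪U* U η, η⟫ = 0`; likewise `V W η = η`, as `V W - 1` has vanishing row
sums over `X`.

Now let `ξ` be orthogonal to the constant vectors of `K`. Subtracting from `ξ` a constant vector
`ζ`, which does not decrease its norm, makes `V (ξ - ζ)` orthogonal to the constant vectors of the
corner. If `ξ` were almost invariant, then so would be `V (ξ - ζ)`
(`exists_almostInvariant_pullOp`), while its norm is bounded below because `1 - W V` has vanishing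
row sums (`exists_norm_le_norm_pullOp`); this contradicts property (T) of `X`.
-/

noncomputable section

namespace CoarseGeometry

/-! ### Colourings, row sums and partial translations -/

open Classical in
theorem exists_injOn_fin {α : Type*} {s : Set α} {M : ℕ} (h : s.encard ≤ M) :
    ∃ c : α → Fin (M + 1), Set.InjOn c s := by
  have hs : s.Finite := Set.finite_of_encard_le_coe h
  obtain ⟨c, -, hc⟩ := hs.exists_injOn_of_encard_le (t := (Set.univ : Set (Fin (M + 1)))) <| by
    refine h.trans ?_
    rw [Set.encard_univ, ENat.card_eq_coe_fintype_card, Fintype.card_fin]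
    exact_mod_cast Nat.le_succ M
  exact ⟨c, hc⟩

section Colouring

variable {X : Type u} [CoarseSpace X]

theorem CoarseSpace.isControlled_relPow {E : SetRel X X} (hE : CoarseSpace.IsControlled E) :
    ∀ n, CoarseSpace.IsControlled (relPow E n)
  | 0 => CoarseSpace.diagonal
  | n + 1 => CoarseSpace.comp hE (isControlled_relPow hE n)

/-- The entries of a controlled set can be coloured with finitely many colours so that each row and
each column meets each colour at most once: the colour of `(x, y)` is the number of `y` in an
enumeration of the row of `x` together with the number of `x` in one of the column of `y`. -/
theorem exists_colouring [BoundedGeometry X] {F : SetRel X X} (hF : CoarseSpace.IsControlled F) :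
    ∃ (M : ℕ) (c : X → X → Fin M × Fin M),
      (∀ x y y', (x, y) ∈ F → (x, y') ∈ F → c x y = c x y' → y = y') ∧
      (∀ x x' y, (x, y) ∈ F → (x', y) ∈ F → c x y = c x' y → x = x') := by
  obtain ⟨M, hM⟩ := BoundedGeometry.exists_bound F hF
  choose c hc using fun x => exists_injOn_fin (hM x)
  refine ⟨M + 1, fun x y => (c x y, c y x), fun x y y' h h' e => ?_, fun x x' y h h' e => ?_⟩
  · exact hc x (Or.inl h) (Or.inl h') (Prod.ext_iff.1 e).1
  · exact hc y (Or.inr h) (Or.inr h') (Prod.ext_iff.1 e).2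

end Colouring

namespace TranslationAlgebra

variable {X : Type u} [CoarseSpace X]

theorem entry_sub (S T : TranslationAlgebra X) (x y : X) :
    (S - T).entry x y = S.entry x y - T.entry x y := rfl

theorem entry_sum {ι : Type*} (s : Finset ι) (T : ι → TranslationAlgebra X) (x y : X) :
    (∑ i ∈ s, T i).entry x y = ∑ i ∈ s, (T i).entry x y := by
  classical
  induction s using Finset.induction_on with
  | empty => simp
  | insert a s ha ih => rw [Finset.sum_insert ha, Finset.sum_insert ha, entry_add, ih]

theorem mem_supp {T : TranslationAlgebra X} {x y : X} : (x, y) ∈ T.supp ↔ T.entry x y ≠ 0 :=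
  Iff.rfl

open Classical in
/-- Diagonal matrices with bounded entries. -/
def diag (d : X → ℂ) (hd : ∃ C : ℝ, ∀ x, ‖d x‖ ≤ C) : TranslationAlgebra X :=
  ⟨Matrix.diagonal d,
    hd.imp fun C hC x y => by
      by_cases h : x = y
      · subst h; simpa using hC x
      · simpa [h] using (norm_nonneg _).trans (hC x),
    CoarseSpace.subset CoarseSpace.diagonal (by
      rintro ⟨x, y⟩ h
      by_contra h'
      exact h (Matrix.diagonal_apply_ne _ h'))⟩

open Classical in
theorem entry_diag (d : X → ℂ) (hd : ∃ C : ℝ, ∀ x, ‖d x‖ ≤ C) (x y : X) :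
    (diag d hd).entry x y = if x = y then d x else 0 :=
  Matrix.diagonal_apply d x y

open Classical in
/-- The matrix of a partially defined map `p`, acting on functions by composition with `p`: its
`(x, y)` entry is `1` if `p x = y`, and `0` otherwise. -/
def partialMapOp (p : X → Option X) (hp : CoarseSpace.IsControlled {q : X × X | p q.1 = some q.2}) :
    TranslationAlgebra X :=
  ⟨fun x y => if p x = some y then 1 else 0,
    ⟨1, fun x y => by by_cases h : p x = some y <;> simp [h]⟩,
    CoarseSpace.subset hp (by
      rintro ⟨x, y⟩ h
      by_contra h'
      exact h (if_neg h'))⟩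

open Classical in
theorem entry_partialMapOp (p : X → Option X) (hp) (x y : X) :
    (partialMapOp p hp).entry x y = if p x = some y then 1 else 0 := rfl

/-- The sum of the entries in a row, a finite sum in the presence of bounded geometry. -/
def rowSum (T : TranslationAlgebra X) (x : X) : ℂ := ∑ᶠ y, T.entry x y

theorem rowSum_eq_sum (T : TranslationAlgebra X) (x : X) (s : Finset X)
    (hs : ∀ y, T.entry x y ≠ 0 → y ∈ s) : T.rowSum x = ∑ y ∈ s, T.entry x y :=
  finsum_eq_sum_of_support_subset _ fun y hy => hs y hy

theorem rowSum_diag (d : X → ℂ) (hd : ∃ C : ℝ, ∀ x, ‖d x‖ ≤ C) (x : X) :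
    (diag d hd).rowSum x = d x := by
  classical
  rw [rowSum_eq_sum _ x {x} fun y hy => by
    by_contra h
    exact hy (by rw [entry_diag, if_neg fun h' => h (by simp [h'])])]
  simp [entry_diag]

theorem rowSum_partialMapOp (p : X → Option X) (hp) (x : X) :
    (partialMapOp p hp).rowSum x = if (p x).isSome then 1 else 0 := by
  classical
  cases h : p x with
  | none => simp [rowSum, entry_partialMapOp, h]
  | some a =>
    rw [rowSum, finsum_eq_single _ a fun y hy => by simp [entry_partialMapOp, h, hy.symm]]
    simp [entry_partialMapOp, h]

variable [BoundedGeometry X]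

theorem rowSum_add (S T : TranslationAlgebra X) (x : X) :
    (S + T).rowSum x = S.rowSum x + T.rowSum x := by
  classical
  obtain ⟨s, hs⟩ := S.exists_row_finset x
  obtain ⟨t, ht⟩ := T.exists_row_finset x
  rw [rowSum_eq_sum S x (s ∪ t) fun z hz => by simp [hs z hz],
    rowSum_eq_sum T x (s ∪ t) fun z hz => by simp [ht z hz],
    rowSum_eq_sum (S + T) x (s ∪ t), ← Finset.sum_add_distrib]
  · rfl
  · intro y hy
    by_contra h
    simp only [Finset.mem_union, not_or] at h
    refine hy ?_
    rw [entry_add, not_not.1 (mt (hs y) h.1), not_not.1 (mt (ht y) h.2), add_zero]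

theorem rowSum_sub (S T : TranslationAlgebra X) (x : X) :
    (S - T).rowSum x = S.rowSum x - T.rowSum x := by
  rw [eq_sub_iff_add_eq, ← rowSum_add, sub_add_cancel]

theorem rowSum_sum {ι : Type*} (s : Finset ι) (T : ι → TranslationAlgebra X) (x : X) :
    (∑ i ∈ s, T i).rowSum x = ∑ i ∈ s, (T i).rowSum x := by
  classical
  induction s using Finset.induction_on with
  | empty => simp [rowSum]
  | insert a s ha ih => rw [Finset.sum_insert ha, Finset.sum_insert ha, rowSum_add, ih]

theorem rowSum_mul (S T : TranslationAlgebra X) (x : X) :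
    (S * T).rowSum x = ∑ᶠ z, S.entry x z * T.rowSum z := by
  classical
  obtain ⟨s, hs⟩ := S.exists_row_finset x
  choose t ht using T.exists_row_finset
  rw [finsum_eq_sum_of_support_subset (s := s) _ fun z hz => hs z fun h => hz (by simp [h]),
    rowSum_eq_sum (S * T) x (s.biUnion t)]
  · simp_rw [entry_mul_eq_sum S T x _ s hs]
    rw [Finset.sum_comm]
    refine Finset.sum_congr rfl fun z hz => ?_
    rw [rowSum_eq_sum T z (s.biUnion t) fun y hy => Finset.mem_biUnion.2 ⟨z, hz, ht z y hy⟩,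
      Finset.mul_sum]
  · intro y hy
    rw [entry_mul_eq_sum S T x y s hs] at hy
    obtain ⟨z, hz, hne⟩ := Finset.exists_ne_zero_of_sum_ne_zero hy
    exact Finset.mem_biUnion.2 ⟨z, hz, ht z y (right_ne_zero_of_mul hne)⟩

/-- The matrices whose rows sum to zero form a left ideal. -/
theorem rowSum_mul_eq_zero (S : TranslationAlgebra X) {T : TranslationAlgebra X}
    (hT : ∀ x, T.rowSum x = 0) (x : X) : (S * T).rowSum x = 0 := by
  simp [rowSum_mul, hT]

theorem entry_diag_mul (d : X → ℂ) (hd : ∃ C : ℝ, ∀ x, ‖d x‖ ≤ C) (T : TranslationAlgebra X)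
    (x y : X) : (diag d hd * T).entry x y = d x * T.entry x y := by
  classical
  rw [entry_mul, finsum_eq_single _ x fun z hz => by simp [entry_diag, hz.symm]]
  simp [entry_diag]

theorem entry_partialMapOp_mul (p : X → Option X) (hp) (T : TranslationAlgebra X) (x y : X) :
    (partialMapOp p hp * T).entry x y = (p x).elim 0 fun z => T.entry z y := by
  classical
  cases h : p x with
  | none => simp [entry_mul, entry_partialMapOp, h]
  | some a =>
    rw [entry_mul, finsum_eq_single _ a fun z hz => by simp [entry_partialMapOp, h, hz.symm]]
    simp [entry_partialMapOp, h]

/-- The entries of a product are bounded in terms of the supports and entries of the factors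
alone. -/
theorem exists_norm_entry_mul_le {F : SetRel X X} (hF : CoarseSpace.IsControlled F) :
    ∃ M : ℕ, ∀ (S T : TranslationAlgebra X) (C D : ℝ), S.supp ⊆ F →
      (∀ x y, ‖S.entry x y‖ ≤ C) → (∀ x y, ‖T.entry x y‖ ≤ D) →
      ∀ x y, ‖(S * T).entry x y‖ ≤ M * (C * D) := by
  obtain ⟨M, hM⟩ := BoundedGeometry.exists_bound F hF
  refine ⟨M, fun S T C D hS hC hD x y => ?_⟩
  have hfin := Set.finite_of_encard_le_coe (hM x)
  have hcard : hfin.toFinset.card ≤ M := by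
    have := hM x
    rw [hfin.encard_eq_coe_toFinset_card] at this
    exact_mod_cast this
  have hC0 : 0 ≤ C := (norm_nonneg _).trans (hC x x)
  have hD0 : 0 ≤ D := (norm_nonneg _).trans (hD x x)
  rw [entry_mul_eq_sum S T x y hfin.toFinset fun z hz => hfin.mem_toFinset.2 (Or.inl (hS hz))]
  calc ‖∑ z ∈ hfin.toFinset, S.entry x z * T.entry z y‖ ≤ ∑ z ∈ hfin.toFinset, C * D :=
        norm_sum_le_of_le _ fun z _ => by
          rw [norm_mul]
          exact mul_le_mul (hC x z) (hD z y) (norm_nonneg _) hC0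
    _ = hfin.toFinset.card * (C * D) := by simp
    _ ≤ M * (C * D) := by gcongr

theorem supp_mul_subset {S T : TranslationAlgebra X} {F G : SetRel X X} (hS : S.supp ⊆ F)
    (hT : T.supp ⊆ G) : (S * T).supp ⊆ F.comp G := by
  rintro ⟨x, y⟩ h
  obtain ⟨z, hz⟩ : ∃ z, S.entry x z * T.entry z y ≠ 0 := by
    by_contra! h'
    exact h ((entry_mul S T x y).trans (by simp [h']))
  exact ⟨z, hS (left_ne_zero_of_mul hz), hT (right_ne_zero_of_mul hz)⟩

end TranslationAlgebra

namespace PartialTranslation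

variable {X : Type u} [CoarseSpace X]

open Classical in
theorem entry_op (t : PartialTranslation X) (x y : X) :
    t.op.entry x y = if t.toPEquiv y = some x then 1 else 0 := rfl

theorem mem_supp_op {t : PartialTranslation X} {x y : X} :
    (x, y) ∈ t.op.supp ↔ t.toPEquiv y = some x := by
  classical
  rw [TranslationAlgebra.mem_supp, entry_op]
  simp

open Classical in
/-- A controlled set which meets each row and each column at most once is the graph of a partial
translation. -/
def ofMatching (G : SetRel X X) (hG : CoarseSpace.IsControlled G)
    (hl : ∀ x y y', (x, y) ∈ G → (x, y') ∈ G → y = y')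
    (hr : ∀ x x' y, (x, y) ∈ G → (x', y) ∈ G → x = x') : PartialTranslation X :=
  { toPEquiv :=
    { toFun := fun y => if h : ∃ x, (x, y) ∈ G then some h.choose else none
      invFun := fun x => if h : ∃ y, (x, y) ∈ G then some h.choose else none
      inv := fun y x => by
        have h1 : (if h : ∃ y, (x, y) ∈ G then some h.choose else none) = some y ↔ (x, y) ∈ G := by
          split_ifs with h
          · rw [Option.some_inj]
            exact ⟨fun e => e ▸ h.choose_spec, fun e => hl _ _ _ h.choose_spec e⟩
          · simpa using fun e => h ⟨y, e⟩
        have h2 : (if h : ∃ x, (x, y) ∈ G then some h.choose else none) = some x ↔ (x, y) ∈ G := by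
          split_ifs with h
          · rw [Option.some_inj]
            exact ⟨fun e => e ▸ h.choose_spec, fun e => hr _ _ _ h.choose_spec e⟩
          · simpa using fun e => h ⟨x, e⟩
        exact h1.trans h2.symm }
    controlled_graph := CoarseSpace.subset hG <| by
      rintro ⟨x, y⟩ h
      change (if h : ∃ x, (x, y) ∈ G then some h.choose else none) = some x at h
      split_ifs at h with h'
      have := h'.choose_spec
      rwa [Option.some_inj.1 h] at this }

theorem ofMatching_eq_some {G : SetRel X X} {hG hl hr} {x y : X} :
    (ofMatching G hG hl hr).toPEquiv y = some x ↔ (x, y) ∈ G := by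
  classical
  change (if h : ∃ x, (x, y) ∈ G then some h.choose else none) = some x ↔ (x, y) ∈ G
  split_ifs with h
  · rw [Option.some_inj]
    exact ⟨fun e => e ▸ h.choose_spec, fun e => hr _ _ _ h.choose_spec e⟩
  · simpa using fun e => h ⟨x, e⟩

theorem ofMatching_symm_eq_some {G : SetRel X X} {hG hl hr} {x y : X} :
    (ofMatching G hG hl hr).toPEquiv.symm x = some y ↔ (x, y) ∈ G :=
  (PEquiv.eq_some_iff _).trans ofMatching_eq_some

theorem op_eq_partialMapOp (t : PartialTranslation X) :
    t.op = TranslationAlgebra.partialMapOp t.toPEquiv.symm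
      (CoarseSpace.subset t.controlled_graph fun _ h => (PEquiv.eq_some_iff _).1 h) := by
  classical
  ext x y
  simp only [entry_op, TranslationAlgebra.entry_partialMapOp, PEquiv.eq_some_iff]

variable [BoundedGeometry X]

/-- `v v*` is the projection onto the range of the partial translation. -/
theorem entry_op_mul_star [DecidableEq X] (t : PartialTranslation X) (x y : X) :
    (t.op * star t.op).entry x y = if x = y ∧ (t.toPEquiv.symm x).isSome then 1 else 0 := by
  rw [op_eq_partialMapOp, TranslationAlgebra.entry_partialMapOp_mul, ← op_eq_partialMapOp]
  cases h : t.toPEquiv.symm x with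
  | none => simp
  | some a =>
    have ha := (PEquiv.eq_some_iff _).1 h
    simp [entry_op, ha]

theorem op_mul_star_eq_diag (t : PartialTranslation X) :
    t.op * star t.op = TranslationAlgebra.diag
      (fun x => if (t.toPEquiv.symm x).isSome then 1 else 0)
      ⟨1, fun x => by split_ifs <;> simp⟩ := by
  classical
  ext x y
  rw [entry_op_mul_star, TranslationAlgebra.entry_diag]
  by_cases h : x = y <;> simp [h]

/-- The operator `v v* - v`, whose rows sum to zero; a vector is invariant if it is annihilated by
all these operators. -/
def defect (t : PartialTranslation X) : TranslationAlgebra X := t.op * star t.op - t.op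

theorem entry_defect [DecidableEq X] (t : PartialTranslation X) (x y : X) :
    t.defect.entry x y = (if x = y ∧ (t.toPEquiv.symm x).isSome then 1 else 0) -
      if t.toPEquiv.symm x = some y then 1 else 0 := by
  rw [defect, TranslationAlgebra.entry_sub, entry_op_mul_star, op_eq_partialMapOp,
    TranslationAlgebra.entry_partialMapOp]
  congr

theorem rowSum_defect (t : PartialTranslation X) (x : X) : t.defect.rowSum x = 0 := by
  classical
  rw [defect, TranslationAlgebra.rowSum_sub, op_mul_star_eq_diag, TranslationAlgebra.rowSum_diag,
    op_eq_partialMapOp, TranslationAlgebra.rowSum_partialMapOp, sub_self]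

theorem norm_entry_defect_le (t : PartialTranslation X) (x y : X) :
    ‖t.defect.entry x y‖ ≤ 2 := by
  classical
  rw [entry_defect]
  refine (norm_sub_le _ _).trans ?_
  have : ∀ (p : Prop) [Decidable p], ‖(if p then 1 else 0 : ℂ)‖ ≤ 1 := fun p _ => by
    split_ifs <;> simp
  linarith [this (x = y ∧ (t.toPEquiv.symm x).isSome), this (t.toPEquiv.symm x = some y)]

theorem supp_defect_subset (t : PartialTranslation X) :
    t.defect.supp ⊆ SetRel.id ∪ t.op.supp := by
  classical
  rintro ⟨x, y⟩ h
  by_contra h'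
  simp only [Set.mem_union, not_or, mem_supp_op] at h'
  refine h ?_
  change t.defect.entry x y = 0
  have h1 : ¬ x = y := h'.1
  rw [entry_defect, if_neg (by tauto), if_neg (by rw [PEquiv.eq_some_iff]; exact h'.2), sub_zero]

theorem op_mul_star_mul_op (t : PartialTranslation X) : t.op * star t.op * t.op = t.op := by
  classical
  ext x y
  rw [op_mul_star_eq_diag, TranslationAlgebra.entry_diag_mul, op_eq_partialMapOp,
    TranslationAlgebra.entry_partialMapOp]
  cases h : t.toPEquiv.symm x <;> simp

/-- The composition `v b*` of a partial translation with the inverse of another one. -/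
def mulStar (t s : PartialTranslation X) : PartialTranslation X where
  toPEquiv := s.toPEquiv.symm.trans t.toPEquiv
  controlled_graph := by
    refine CoarseSpace.subset
      (CoarseSpace.comp t.controlled_graph (CoarseSpace.inv s.controlled_graph)) ?_
    rintro ⟨x, y⟩ h
    obtain ⟨z, hz, hz'⟩ := (PEquiv.mem_trans _ _ _ _).1 h
    exact ⟨z, hz', (PEquiv.eq_some_iff _).1 hz⟩

theorem op_mulStar (t s : PartialTranslation X) : (t.mulStar s).op = t.op * star s.op := by
  classical
  ext x y
  rw [op_eq_partialMapOp t, TranslationAlgebra.entry_partialMapOp_mul, entry_op]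
  have key : (t.mulStar s).toPEquiv y = some x ↔
      ∃ z, s.toPEquiv z = some y ∧ t.toPEquiv.symm x = some z := by
    change x ∈ s.toPEquiv.symm.trans t.toPEquiv y ↔ _
    rw [PEquiv.mem_trans]
    simp only [Option.mem_def, PEquiv.eq_some_iff]
  cases h : t.toPEquiv.symm x with
  | none =>
    rw [if_neg]
    · simp
    · rw [key]; simp [h]
  | some a =>
    simp [key, h, entry_op, apply_ite]

end PartialTranslation

/-! ### Norm bounds and almost invariant vectors -/

section Bounds

variable {X : Type u} [CoarseSpace X] [BoundedGeometry X]
  {H : Type w} [NormedAddCommGroup H] [InnerProductSpace ℂ H] [CompleteSpace H]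

open scoped InnerProductSpace

theorem Representation.inner_map_star (π : Representation X H) (T : TranslationAlgebra X)
    (ξ η : H) : ⟪π (star T) ξ, η⟫_ℂ = ⟪ξ, π T η⟫_ℂ := by
  rw [map_star, ContinuousLinearMap.star_eq_adjoint, ContinuousLinearMap.adjoint_inner_left]

theorem Representation.mul_apply (π : Representation X H) (S T : TranslationAlgebra X) (ξ : H) :
    π (S * T) ξ = π S (π T ξ) := by
  rw [map_mul]; rfl

/-- The norm of `π T` is at most `C` in every representation `π` if `C² - T* T` is of the form
`S* S`. -/
theorem Representation.norm_apply_le_of_star_mul_add (π : Representation X H)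
    {S T : TranslationAlgebra X} {C : ℝ} (hC : 0 ≤ C)
    (h : star T * T + star S * S = ((C ^ 2 : ℝ) : ℂ) • 1) (ξ : H) : ‖π T ξ‖ ≤ C * ‖ξ‖ := by
  have key : ∀ T : TranslationAlgebra X, (⟪π (star T * T) ξ, ξ⟫_ℂ) = ((‖π T ξ‖ ^ 2 : ℝ) : ℂ) := by
    intro T
    rw [π.mul_apply, π.inner_map_star, inner_self_eq_norm_sq_to_K]
    simp
  have h1 : ((‖π T ξ‖ ^ 2 : ℝ) : ℂ) + ((‖π S ξ‖ ^ 2 : ℝ) : ℂ) = ((C ^ 2 * ‖ξ‖ ^ 2 : ℝ) : ℂ) := by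
    rw [← key, ← key, ← inner_add_left, ← add_apply, ← map_add, h, map_smul,
      map_one]
    rw [smul_apply, one_apply_eq_self, inner_smul_left,
      inner_self_eq_norm_sq_to_K]
    simp
  have h2 : ‖π T ξ‖ ^ 2 + ‖π S ξ‖ ^ 2 = C ^ 2 * ‖ξ‖ ^ 2 := by exact_mod_cast h1
  refine abs_le_of_sq_le_sq' ?_ (by positivity) |>.2
  nlinarith [sq_nonneg ‖π S ξ‖]

/-- Diagonal matrices act by operators of norm at most the supremum of their entries; here the
square root `S` of `C² - D* D` is itself a diagonal matrix of the translation algebra. -/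
theorem Representation.norm_diag_apply_le (π : Representation X H) (d : X → ℂ) {C : ℝ}
    (hC : 0 ≤ C) (hd : ∀ x, ‖d x‖ ≤ C) (ξ : H) :
    ‖π (TranslationAlgebra.diag d ⟨C, hd⟩) ξ‖ ≤ C * ‖ξ‖ := by
  classical
  have hs : ∀ x, ‖((Real.sqrt (C ^ 2 - ‖d x‖ ^ 2) : ℝ) : ℂ)‖ ≤ C := fun x => by
    rw [Complex.norm_real, Real.norm_of_nonneg (Real.sqrt_nonneg _)]
    exact Real.sqrt_le_iff.2 ⟨hC, by linarith [sq_nonneg ‖d x‖]⟩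
  refine π.norm_apply_le_of_star_mul_add (S := TranslationAlgebra.diag _ ⟨C, hs⟩) hC ?_ ξ
  have hstar : ∀ (e : X → ℂ) (he : ∃ C : ℝ, ∀ x, ‖e x‖ ≤ C),
      star (TranslationAlgebra.diag e he) =
        TranslationAlgebra.diag (fun x => star (e x)) (by simpa using he) := by
    intro e he
    ext x y
    by_cases h : x = y
    · subst h; simp [TranslationAlgebra.entry_diag]
    · simp [TranslationAlgebra.entry_diag, h, Ne.symm h]
  ext x y
  rw [TranslationAlgebra.entry_add, hstar, hstar, TranslationAlgebra.entry_diag_mul,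
    TranslationAlgebra.entry_diag_mul, TranslationAlgebra.entry_diag,
    TranslationAlgebra.entry_diag, TranslationAlgebra.entry_smul, TranslationAlgebra.entry_one]
  by_cases h : x = y
  · simp only [if_pos h, mul_one]
    have h0 : 0 ≤ C ^ 2 - ‖d x‖ ^ 2 := by
      have := pow_le_pow_left₀ (norm_nonneg _) (hd x) 2
      linarith
    have h1 : star (d x) * d x = ((‖d x‖ ^ 2 : ℝ) : ℂ) := by
      rw [Complex.star_def, Complex.conj_mul']; push_cast; rfl
    rw [h1, Complex.star_def, Complex.conj_ofReal, ← Complex.ofReal_mul, Real.mul_self_sqrt h0,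
      ← Complex.ofReal_add]
    congr 1; ring
  · simp [h]

theorem Representation.norm_op_apply_le (π : Representation X H) (t : PartialTranslation X)
    (ξ : H) : ‖π t.op ξ‖ ≤ ‖ξ‖ := by
  have h := π.norm_apply_le_of_star_mul_add (T := t.op) (S := 1 - star t.op * t.op) zero_le_one
    ?_ ξ
  · simpa using h
  · have h1 : star t.op * t.op * (star t.op * t.op) = star t.op * t.op := by
      rw [mul_assoc, ← mul_assoc t.op, t.op_mul_star_mul_op]
    simp only [star_sub, star_one, star_mul, star_star, mul_sub, sub_mul, one_mul, mul_one, h1]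
    simp

/-- A bounded matrix `T` with support in `F` is a finite sum `∑ₖ Dₖ vₖ` with `Dₖ` diagonal and
`vₖ` a partial translation supported in `F`. The row sums of `T` are the entries of
`∑ₖ Dₖ vₖ vₖ*`, so that `T = -∑ₖ Dₖ (vₖ vₖ* - vₖ)` if they vanish. The number of terms depends
only on `F`. -/
theorem TranslationAlgebra.exists_eq_sum_diag_mul_op {F : SetRel X X}
    (hF : CoarseSpace.IsControlled F) : ∃ M : ℕ, ∀ T : TranslationAlgebra X, T.supp ⊆ F →
      ∀ C : ℝ, 0 ≤ C → (∀ x y, ‖T.entry x y‖ ≤ C) →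
      ∃ (d : Fin M × Fin M → X → ℂ) (hd : ∀ k x, ‖d k x‖ ≤ C)
        (t : Fin M × Fin M → PartialTranslation X), (∀ k, (t k).op.supp ⊆ F) ∧
        T = ∑ k, diag (d k) ⟨C, hd k⟩ * (t k).op ∧
        ((∀ x, T.rowSum x = 0) → T = -∑ k, diag (d k) ⟨C, hd k⟩ * (t k).defect) := by
  classical
  obtain ⟨M, c, hl, hr⟩ := exists_colouring hF
  refine ⟨M, fun T hT C hC hTC => ?_⟩
  let t : Fin M × Fin M → PartialTranslation X := fun k => PartialTranslation.ofMatching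
    {p | p ∈ F ∧ c p.1 p.2 = k} (CoarseSpace.subset hF fun p h => h.1)
    (fun x y y' h h' => hl x y y' h.1 h'.1 (h.2.trans h'.2.symm))
    (fun x x' y h h' => hr x x' y h.1 h'.1 (h.2.trans h'.2.symm))
  have ht : ∀ k x y, (t k).toPEquiv.symm x = some y ↔ (x, y) ∈ F ∧ c x y = k := fun k x y =>
    PartialTranslation.ofMatching_symm_eq_some
  let d : Fin M × Fin M → X → ℂ := fun k x => ((t k).toPEquiv.symm x).elim 0 (T.entry x)
  have hd : ∀ k x, ‖d k x‖ ≤ C := fun k x => by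
    dsimp only [d]
    cases (t k).toPEquiv.symm x with
    | none => simpa using hC
    | some a => exact hTC x a
  have hop : T = ∑ k, diag (d k) ⟨C, hd k⟩ * (t k).op := by
    ext x y
    simp only [entry_sum, entry_diag_mul, PartialTranslation.op_eq_partialMapOp,
      entry_partialMapOp]
    have : ∀ k, (d k x * if (t k).toPEquiv.symm x = some y then 1 else 0) =
        if k = c x y then T.entry x y else 0 := fun k => by
      by_cases h : (t k).toPEquiv.symm x = some y
      · have hk : k = c x y := ((ht k x y).1 h).2.symm
        rw [if_pos h, if_pos hk, mul_one]
        simp only [d, h, Option.elim_some]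
      · rw [if_neg h, mul_zero]
        split_ifs with hk
        · by_contra h0
          exact h ((ht k x y).2 ⟨hT (Ne.symm h0), hk.symm⟩)
        · rfl
    simp [this]
  refine ⟨d, hd, t, fun k => ?_, hop, fun h0 => ?_⟩
  · rintro ⟨x, y⟩ h
    rw [PartialTranslation.mem_supp_op, ← PEquiv.eq_some_iff, ht] at h
    exact h.1
  · have hdiag : ∀ k, diag (d k) ⟨C, hd k⟩ * ((t k).op * star (t k).op) =
        diag (d k) ⟨C, hd k⟩ := fun k => by
      ext x y
      rw [entry_diag_mul, PartialTranslation.entry_op_mul_star, entry_diag]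
      by_cases hxy : x = y
      · simp only [hxy, true_and, d]
        cases (t k).toPEquiv.symm y <;> simp
      · simp [hxy]
    have hrow : ∀ x, ∑ k, d k x = 0 := fun x => by
      rw [← h0 x, hop, rowSum_sum]
      refine Finset.sum_congr rfl fun k _ => ?_
      rw [rowSum_mul, finsum_eq_single _ x fun z hz => by simp [entry_diag, hz.symm],
        PartialTranslation.op_eq_partialMapOp, rowSum_partialMapOp, entry_diag, if_pos rfl]
      dsimp only [d]
      cases (t k).toPEquiv.symm x <;> simp
    have hzero : ∑ k, diag (d k) ⟨C, hd k⟩ = 0 := by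
      ext x y
      by_cases hxy : x = y <;> simp [entry_sum, entry_diag, hxy, hrow]
    simp only [PartialTranslation.defect, mul_sub, hdiag, Finset.sum_sub_distrib, hzero, ← hop]
    simp

/-- The norm of an element of the translation algebra is bounded uniformly over all
representations. -/
theorem Representation.exists_norm_apply_le (T : TranslationAlgebra X) :
    ∃ N : ℝ, 0 ≤ N ∧ ∀ (H : Type w) [NormedAddCommGroup H] [InnerProductSpace ℂ H]
      [CompleteSpace H] (π : Representation X H) (ξ : H), ‖π T ξ‖ ≤ N * ‖ξ‖ := by
  obtain ⟨C, hC⟩ := T.exists_bound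
  obtain ⟨M, hM⟩ := TranslationAlgebra.exists_eq_sum_diag_mul_op T.controlled_supp
  obtain ⟨d, hd, t, -, hT, -⟩ := hM T subset_rfl (max C 0) (le_max_right _ _)
    fun x y => (hC x y).trans (le_max_left _ _)
  refine ⟨(M * M : ℕ) * max C 0, by positivity, fun H _ _ _ π ξ => ?_⟩
  rw [hT, map_sum, sum_apply]
  refine (norm_sum_le_of_le (n := fun _ => max C 0 * ‖ξ‖) _ fun k _ => ?_).trans ?_
  · rw [π.mul_apply]
    exact (π.norm_diag_apply_le _ (le_max_right _ _) (hd k) _).trans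
      (mul_le_mul_of_nonneg_left (π.norm_op_apply_le _ _) (le_max_right _ _))
  · simp [mul_assoc]

end Bounds

section Propagation

variable {X : Type u} [CoarseSpace X] [BoundedGeometry X]
  {H : Type w} [NormedAddCommGroup H] [InnerProductSpace ℂ H] [CompleteSpace H]

/-- The vector `ξ` is moved by at most `δ` by the partial translations supported in `F`. -/
def AlmostInvariant (π : Representation X H) (F : SetRel X X) (δ : ℝ) (ξ : H) : Prop :=
  ∀ t : PartialTranslation X, t.op.supp ⊆ F → ‖π t.defect ξ‖ ≤ δ

theorem mem_constantVectors_iff {π : Representation X H} {ξ : H} :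
    ξ ∈ constantVectors π ↔ ∀ t : PartialTranslation X, π t.defect ξ = 0 := by
  refine forall_congr' fun t => ?_
  rw [PartialTranslation.defect, map_sub, sub_apply, sub_eq_zero, eq_comm]

/-- If `v = a b` with `a = v b*`, then `v v* - v = (a a* - a) + a (b b* - b)`. -/
theorem norm_defect_le_of_mul (π : Representation X H) (v b : PartialTranslation X)
    (h : v.op * (star b.op * b.op) = v.op) (ξ : H) :
    ‖π v.defect ξ‖ ≤ ‖π (v.mulStar b).defect ξ‖ + ‖π b.defect ξ‖ := by
  have h' : v.op * star b.op * b.op = v.op := by rw [mul_assoc, h]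
  have key : v.defect = (v.mulStar b).defect + (v.mulStar b).op * b.defect := by
    simp only [PartialTranslation.defect, PartialTranslation.op_mulStar, star_mul, star_star,
      mul_sub]
    rw [h', ← mul_assoc _ b.op, h', ← mul_assoc _ b.op, h']
    abel
  rw [key, map_add, add_apply, π.mul_apply]
  exact (norm_add_le _ _).trans (add_le_add_right (π.norm_op_apply_le _ _) _)

/-- A partial translation `v` supported in `E ∘ F` is cut into boundedly many pieces, each of which
is the product of a partial translation supported in `E` with one supported in `F`. -/
theorem AlmostInvariant.comp (E : SetRel X X) {F : SetRel X X}
    (hF : CoarseSpace.IsControlled F) :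
    ∃ M : ℕ, ∀ (H : Type w) [NormedAddCommGroup H] [InnerProductSpace ℂ H] [CompleteSpace H]
      (π : Representation X H) (ξ : H) (δ ε : ℝ), AlmostInvariant π E δ ξ →
      AlmostInvariant π F ε ξ → AlmostInvariant π (E.comp F) (M * (δ + ε)) ξ := by
  classical
  obtain ⟨M, c, hl, hr⟩ := exists_colouring hF
  refine ⟨M * M, fun H _ _ _ π ξ δ ε hδ hε v hv => ?_⟩
  -- a point `z y` on the way from `y` to `v y`
  have hz : ∀ y, ∃ z, ∀ x, v.toPEquiv y = some x → (x, z) ∈ E ∧ (z, y) ∈ F := fun y => by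
    cases h : v.toPEquiv y with
    | none => exact ⟨y, by simp⟩
    | some x =>
      obtain ⟨z, h1, h2⟩ := hv (PartialTranslation.mem_supp_op.2 h)
      exact ⟨z, fun x' hx' => by rw [← Option.some_inj.1 hx']; exact ⟨h1, h2⟩⟩
  choose z hz using hz
  -- the part of `v` of colour `k`, on which `z` is injective
  let V : Fin M × Fin M → PartialTranslation X := fun k => PartialTranslation.ofMatching
    {p | v.toPEquiv p.2 = some p.1 ∧ c (z p.2) p.2 = k}
    (CoarseSpace.subset v.controlled_graph fun p h => h.1)
    (fun x y y' h h' => by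
      have h1 := (PEquiv.eq_some_iff _).2 h.1
      have h2 := (PEquiv.eq_some_iff _).2 h'.1
      exact Option.some_inj.1 (h1.symm.trans h2))
    (fun x x' y h h' => Option.some_inj.1 (h.1.symm.trans h'.1))
  let B : Fin M × Fin M → PartialTranslation X := fun k => PartialTranslation.ofMatching
    {p | (∃ x, v.toPEquiv p.2 = some x) ∧ z p.2 = p.1 ∧ c (z p.2) p.2 = k}
    (CoarseSpace.subset hF fun p h => by
      obtain ⟨⟨x, hx⟩, hp, -⟩ := h
      have := (hz _ _ hx).2
      rwa [hp] at this)
    (fun x y y' h h' => by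
      obtain ⟨⟨a, ha⟩, h1, h2⟩ := h
      obtain ⟨⟨a', ha'⟩, h1', h2'⟩ := h'
      dsimp only at *
      have e1 := (hz _ _ ha).2
      have e2 := (hz _ _ ha').2
      rw [h1] at h2 e1
      rw [h1'] at h2' e2
      exact hl x y y' e1 e2 (h2.trans h2'.symm))
    (fun x x' y h h' => h.2.1.symm.trans h'.2.1)
  have hV : ∀ k x y, (V k).toPEquiv.symm x = some y ↔
      v.toPEquiv.symm x = some y ∧ c (z y) y = k := fun k x y => by
    rw [PartialTranslation.ofMatching_symm_eq_some, PEquiv.eq_some_iff]; rfl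
  have hB : ∀ k x y, (B k).toPEquiv y = some x ↔
      (∃ x, v.toPEquiv y = some x) ∧ z y = x ∧ c (z y) y = k :=
    fun k x y => PartialTranslation.ofMatching_eq_some
  have hsum : v.defect = ∑ k, (V k).defect := by
    ext x y
    rw [TranslationAlgebra.entry_sum]
    simp only [PartialTranslation.entry_defect, Finset.sum_sub_distrib, hV]
    congr 1
    · cases h : v.toPEquiv.symm x with
      | none =>
        have : ∀ k, (V k).toPEquiv.symm x = none := fun k => by
          by_contra h'
          obtain ⟨a, ha⟩ := Option.ne_none_iff_exists'.1 h'
          rw [hV, h] at ha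
          simp at ha
        simp [this]
      | some a =>
        have : ∀ k, ((V k).toPEquiv.symm x).isSome ↔ k = c (z a) a := fun k => by
          rw [Option.isSome_iff_exists]
          simp only [hV, h, Option.some_inj]
          exact ⟨fun ⟨b, hb, hk⟩ => by rw [hb, hk], fun hk => ⟨a, rfl, hk.symm⟩⟩
        by_cases hxy : x = y
        · simp only [this]; simp [hxy]
        · simp [hxy]
    · by_cases h : v.toPEquiv.symm x = some y <;> simp [h]
  have hk : ∀ k, ‖π (V k).defect ξ‖ ≤ δ + ε := fun k => by
    refine (norm_defect_le_of_mul π (V k) (B k) ?_ ξ).trans (add_le_add (hδ _ ?_) (hε _ ?_))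
    · ext x y
      rw [PartialTranslation.op_eq_partialMapOp (V k), TranslationAlgebra.entry_partialMapOp_mul,
        TranslationAlgebra.entry_partialMapOp]
      cases h : (V k).toPEquiv.symm x with
      | none => simp
      | some a =>
        obtain ⟨h1, h2⟩ := (hV _ _ _).1 h
        have h3 : (B k).toPEquiv a = some (z a) :=
          (hB _ _ _).2 ⟨⟨x, (PEquiv.eq_some_iff _).1 h1⟩, rfl, h2⟩
        have h4 : ∀ b, (B k).toPEquiv b = some (z a) ↔ b = a := fun b =>
          ⟨fun hb => Option.some_inj.1
            (((PEquiv.eq_some_iff _).2 hb).symm.trans ((PEquiv.eq_some_iff _).2 h3)),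
            fun hb => hb ▸ h3⟩
        change (star (B k).op * (B k).op).entry a y = _
        rw [TranslationAlgebra.entry_mul, finsum_eq_single _ (z a) fun b hb => by
          have : (B k).toPEquiv a ≠ some b := by rw [h3]; simpa using hb.symm
          simp [PartialTranslation.entry_op, this]]
        simp [PartialTranslation.entry_op, h4, eq_comm]
    · rintro ⟨x, y⟩ h
      rw [PartialTranslation.mem_supp_op] at h
      obtain ⟨a, ha, ha'⟩ := (PEquiv.mem_trans _ _ _ _).1 h
      have h1 := (hB _ _ _).1 ((PEquiv.eq_some_iff _).1 ha)
      have h2 := (PEquiv.eq_some_iff _).1 ((hV _ _ _).1 ((PEquiv.eq_some_iff _).2 ha')).1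
      have := (hz _ _ h2).1
      rwa [h1.2.1] at this
    · rintro ⟨x, y⟩ h
      rw [PartialTranslation.mem_supp_op, hB] at h
      obtain ⟨⟨a, ha⟩, h1, h2⟩ := h
      have := (hz _ _ ha).2
      rwa [h1] at this
  rw [hsum, map_sum, sum_apply]
  refine (norm_sum_le_of_le _ fun k _ => hk k).trans ?_
  simp [mul_add]

theorem AlmostInvariant.relPow {E : SetRel X X} (hE : CoarseSpace.IsControlled E) (n : ℕ) :
    ∃ κ : ℝ, ∀ (H : Type w) [NormedAddCommGroup H] [InnerProductSpace ℂ H] [CompleteSpace H]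
      (π : Representation X H) (ξ : H) (δ : ℝ), AlmostInvariant π E δ ξ →
      AlmostInvariant π (relPow E n) (κ * δ) ξ := by
  classical
  induction n with
  | zero =>
    refine ⟨0, fun H _ _ _ π ξ δ _ t ht => ?_⟩
    have : t.defect = 0 := by
      ext x y
      have hxy : t.toPEquiv.symm x = some y → x = y := fun h =>
        ht (PartialTranslation.mem_supp_op.2 ((PEquiv.eq_some_iff _).1 h))
      rw [PartialTranslation.entry_defect]
      cases h : t.toPEquiv.symm x with
      | none => simp
      | some a =>
        have hxa : x = a :=
          ht (PartialTranslation.mem_supp_op.2 ((PEquiv.eq_some_iff _).1 h))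
        simp [hxa]
    simp [this]
  | succ n ih =>
    obtain ⟨κ, hκ⟩ := ih
    obtain ⟨M, hM⟩ := AlmostInvariant.comp.{u, w} E (CoarseSpace.isControlled_relPow hE n)
    refine ⟨M * (1 + κ), fun H _ _ _ π ξ δ h => ?_⟩
    have := hM H π ξ δ (κ * δ) h (hκ H π ξ δ h)
    rwa [show (M : ℝ) * (1 + κ) * δ = M * (δ + κ * δ) by ring]

/-- Almost invariance under the partial translations supported in a generating set passes to all
matrices with vanishing row sums, with a constant depending only on a controlled set containing the
support and on a bound for the entries. -/
theorem IsGenerating.exists_norm_apply_le {E F : SetRel X X} (hE : IsGenerating E)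
    (hF : CoarseSpace.IsControlled F) {C : ℝ} (hC : 0 ≤ C) :
    ∃ κ : ℝ, 0 ≤ κ ∧ ∀ (H : Type w) [NormedAddCommGroup H] [InnerProductSpace ℂ H]
      [CompleteSpace H] (π : Representation X H) (ξ : H) (δ : ℝ), AlmostInvariant π E δ ξ →
      ∀ T : TranslationAlgebra X, T.supp ⊆ F → (∀ x y, ‖T.entry x y‖ ≤ C) →
      (∀ x, T.rowSum x = 0) → ‖π T ξ‖ ≤ κ * δ := by
  obtain ⟨n, -, hn⟩ := hE.2 F hF
  obtain ⟨κ, hκ⟩ := AlmostInvariant.relPow.{u, w} hE.1 n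
  obtain ⟨M, hM⟩ := TranslationAlgebra.exists_eq_sum_diag_mul_op hF
  refine ⟨(M * M : ℕ) * C * max κ 0, by positivity, fun H _ _ _ π ξ δ hδ T hTF hTC hT => ?_⟩
  obtain ⟨d, hd, t, ht, -, h⟩ := hM T hTF C hC hTC
  -- the empty partial translation shows that `δ` is nonnegative
  have hδ0 : 0 ≤ δ := (norm_nonneg _).trans (hδ
    (PartialTranslation.ofMatching ∅ (CoarseSpace.subset hF (Set.empty_subset _))
      (by simp) (by simp)) fun p hp => by
        obtain ⟨x, y⟩ := p
        rw [PartialTranslation.mem_supp_op, PartialTranslation.ofMatching_eq_some] at hp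
        simp at hp)
  rw [h hT, map_neg, neg_apply, norm_neg, map_sum, sum_apply]
  refine (norm_sum_le_of_le (n := fun _ => C * (max κ 0 * δ)) _ fun k _ => ?_).trans ?_
  · rw [π.mul_apply]
    refine (π.norm_diag_apply_le _ hC (hd k) _).trans (mul_le_mul_of_nonneg_left ?_ hC)
    refine (hκ H π ξ δ hδ (t k) ((ht k).trans hn)).trans ?_
    gcongr
    exact le_max_left _ _
  · simp [mul_assoc]

/-- Constant vectors are annihilated by all matrices with vanishing row sums. -/
theorem apply_eq_zero_of_mem_constantVectors {π : Representation X H} {ξ : H}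
    (hξ : ξ ∈ constantVectors π) {T : TranslationAlgebra X} (hT : ∀ x, T.rowSum x = 0) :
    π T ξ = 0 := by
  obtain ⟨C, hC⟩ := T.exists_bound
  obtain ⟨M, hM⟩ := TranslationAlgebra.exists_eq_sum_diag_mul_op T.controlled_supp
  obtain ⟨d, hd, t, -, -, h⟩ := hM T subset_rfl (max C 0) (le_max_right _ _)
    fun x y => (hC x y).trans (le_max_left _ _)
  rw [h hT, map_neg, neg_apply, map_sum, sum_apply]
  simp [mem_constantVectors_iff.1 hξ]

theorem isClosed_constantVectors (π : Representation X H) :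
    IsClosed (constantVectors π : Set H) := by
  have : (constantVectors π : Set H) = ⋂ t : PartialTranslation X, {ξ | π t.defect ξ = 0} := by
    ext ξ
    simp [mem_constantVectors_iff]
  rw [this]
  exact isClosed_iInter fun t => isClosed_eq (π t.defect).continuous continuous_const

end Propagation

/-! ### Amplification, extension by zero and corners -/

section Amplification

variable {Y : Type v} [CoarseSpace Y]

/-- The coarse structure on `n` copies of `Y`: a set is controlled if its projection to `Y` is. -/
instance (n : ℕ) : CoarseSpace (Y × Fin n) where
  IsControlled E :=
    ∃ F : SetRel Y Y, CoarseSpace.IsControlled F ∧ ∀ a b, (a, b) ∈ E → (a.1, b.1) ∈ F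
  diagonal := ⟨SetRel.id, CoarseSpace.diagonal, fun _ _ h => congrArg Prod.fst h⟩
  subset := fun ⟨F, hF, h⟩ h' => ⟨F, hF, fun a b hab => h a b (h' hab)⟩
  union := fun ⟨F, hF, h⟩ ⟨F', hF', h'⟩ => ⟨F ∪ F', CoarseSpace.union hF hF', fun a b hab =>
    hab.imp (h a b) (h' a b)⟩
  comp := fun ⟨F, hF, h⟩ ⟨F', hF', h'⟩ => ⟨F.comp F', CoarseSpace.comp hF hF',
    fun a b ⟨c, hc, hc'⟩ => ⟨c.1, h a c hc, h' c b hc'⟩⟩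
  inv := fun ⟨F, hF, h⟩ => ⟨F.inv, CoarseSpace.inv hF, fun a b hab => h b a hab⟩

instance [BoundedGeometry Y] (n : ℕ) : BoundedGeometry (Y × Fin n) where
  exists_bound := by
    rintro E ⟨F, hF, h⟩
    obtain ⟨M, hM⟩ := BoundedGeometry.exists_bound F hF
    refine ⟨M * n, fun a => ?_⟩
    calc {b | (a, b) ∈ E ∪ E.inv}.encard
        ≤ ({y | (a.1, y) ∈ F ∪ F.inv} ×ˢ (Set.univ : Set (Fin n))).encard :=
          Set.encard_le_encard fun b hb => ⟨hb.imp (h a b) (h b a), trivial⟩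
      _ = {y | (a.1, y) ∈ F ∪ F.inv}.encard * n := by
          rw [Set.encard_prod, Set.encard_univ]; simp
      _ ≤ (M * n : ℕ) := by
          push_cast
          exact mul_le_mul_left (hM a.1) _

end Amplification

namespace TranslationAlgebra

variable {X : Type u} {Z : Type v} [CoarseSpace X] [CoarseSpace Z]

/-- The matrix with entries `T (α x) (β y)`. -/
def reindex (α β : X → Z)
    (h : ∀ E : SetRel Z Z, CoarseSpace.IsControlled E →
      CoarseSpace.IsControlled ({p | (α p.1, β p.2) ∈ E} : SetRel X X))
    (T : TranslationAlgebra Z) : TranslationAlgebra X :=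
  ⟨fun x y => T.entry (α x) (β y), T.exists_bound.imp fun _ hC _ _ => hC _ _,
    CoarseSpace.subset (h _ T.controlled_supp) fun _ hp => hp⟩

theorem entry_reindex (α β : X → Z) (h) (T : TranslationAlgebra Z) (x y : X) :
    (reindex α β h T).entry x y = T.entry (α x) (β y) := rfl

/-- Extension by zero of a matrix along an injective map. -/
def extend (φ : X → Z) (hφ : UniformlyExpansive φ) (hi : Function.Injective φ)
    (T : TranslationAlgebra X) : TranslationAlgebra Z :=
  ⟨fun a b => (Function.partialInv φ a).elim 0 fun x =>
      (Function.partialInv φ b).elim 0 (T.entry x),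
    ⟨max T.exists_bound.choose 0, fun a b => by
      dsimp only
      cases Function.partialInv φ a with
      | none => simp
      | some x =>
        cases Function.partialInv φ b with
        | none => simp
        | some y => exact (T.exists_bound.choose_spec x y).trans (le_max_left _ _)⟩,
    CoarseSpace.subset (hφ _ T.controlled_supp) (by
      have hp := hi.isPartialInv
      rintro ⟨a, b⟩ h
      simp only [matrixSupport, Set.mem_ofPred_eq] at h
      cases ha : Function.partialInv φ a with
      | none => simp [ha] at h
      | some x =>
        cases hb : Function.partialInv φ b with
        | none => simp [ha, hb] at h
        | some y =>
          refine ⟨x, y, ?_, ?_⟩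
          · simp only [ha, hb, Option.elim_some] at h
            exact h
          · rw [(hp x a).1 ha, (hp y b).1 hb])⟩

section Extend

variable {φ : X → Z} (hφ : UniformlyExpansive φ) (hi : Function.Injective φ)

theorem entry_extend (T : TranslationAlgebra X) (a b : Z) : (extend φ hφ hi T).entry a b =
    (Function.partialInv φ a).elim 0 fun x => (Function.partialInv φ b).elim 0 (T.entry x) := rfl

theorem entry_extend_apply (T : TranslationAlgebra X) (x y : X) :
    (extend φ hφ hi T).entry (φ x) (φ y) = T.entry x y := by
  rw [entry_extend, Function.partialInv_left hi, Function.partialInv_left hi]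
  rfl

theorem entry_extend_of_notMem_left (T : TranslationAlgebra X) {a : Z} (ha : a ∉ Set.range φ)
    (b : Z) : (extend φ hφ hi T).entry a b = 0 := by
  cases h : Function.partialInv φ a with
  | none => rw [entry_extend, h]; rfl
  | some x => exact absurd ⟨x, (hi.isPartialInv x a).1 h⟩ ha

theorem entry_extend_of_notMem (T : TranslationAlgebra X) (a : Z) {b : Z}
    (hb : b ∉ Set.range φ) : (extend φ hφ hi T).entry a b = 0 := by
  cases h : Function.partialInv φ b with
  | none =>
    rw [entry_extend, h]
    cases Function.partialInv φ a <;> rfl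
  | some x => exact absurd ⟨x, (hi.isPartialInv x b).1 h⟩ hb

theorem rowSum_extend [BoundedGeometry X] (T : TranslationAlgebra X) (x : X) :
    (extend φ hφ hi T).rowSum (φ x) = T.rowSum x := by
  have hp := hi.isPartialInv
  obtain ⟨s, hs⟩ := T.exists_row_finset x
  rw [rowSum_eq_sum T x s hs, rowSum_eq_sum _ _ (s.map ⟨φ, hi⟩), Finset.sum_map]
  · simp [entry_extend_apply]
  · intro c hc
    rw [entry_extend, Function.partialInv_left hi] at hc
    cases hc' : Function.partialInv φ c with
    | none => simp [hc'] at hc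
    | some z => exact Finset.mem_map.2 ⟨z, hs z (by simpa [hc'] using hc), (hp z c).1 hc'⟩

theorem extend_reindex (hc : ∀ E : SetRel Z Z, CoarseSpace.IsControlled E →
      CoarseSpace.IsControlled ({p | (φ p.1, φ p.2) ∈ E} : SetRel X X))
    {T : TranslationAlgebra Z} (h1 : ∀ a, a ∉ Set.range φ → ∀ b, T.entry a b = 0)
    (h2 : ∀ b, b ∉ Set.range φ → ∀ a, T.entry a b = 0) :
    extend φ hφ hi (reindex φ φ hc T) = T := by
  have hp := hi.isPartialInv
  have hn : ∀ a, Function.partialInv φ a = none → a ∉ Set.range φ := by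
    rintro a ha ⟨x, hx⟩
    rw [(hp x a).2 hx] at ha
    simp at ha
  ext a b
  rw [entry_extend]
  cases ha : Function.partialInv φ a with
  | none => rw [h1 a (hn a ha)]; rfl
  | some x =>
    cases hb : Function.partialInv φ b with
    | none => rw [h2 b (hn b hb)]; rfl
    | some y => simp [entry_reindex, (hp x a).1 ha, (hp y b).1 hb]

theorem rowSum_extend_of_notMem (T : TranslationAlgebra X) {a : Z} (ha : a ∉ Set.range φ) :
    (extend φ hφ hi T).rowSum a = 0 := by
  simp [rowSum, entry_extend_of_notMem_left hφ hi T ha]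

variable [BoundedGeometry Z]

theorem extend_one_mul {T : TranslationAlgebra Z}
    (hT : ∀ a, a ∉ Set.range φ → ∀ b, T.entry a b = 0) : extend φ hφ hi 1 * T = T := by
  classical
  have hp := hi.isPartialInv
  ext a b
  cases ha : Function.partialInv φ a with
  | none =>
    rw [hT a, entry_mul]
    · simp [entry_extend, ha]
    · rintro ⟨x, hx⟩
      rw [(hp x a).2 hx] at ha
      simp at ha
  | some x =>
    obtain rfl := (hp x a).1 ha
    rw [entry_mul, finsum_eq_single _ (φ x), entry_extend_apply]
    · simp [entry_one]
    · intro c hc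
      rw [entry_extend, ha]
      cases hc' : Function.partialInv φ c with
      | none => simp
      | some z =>
        have : x ≠ z := fun e => hc (by rw [e, (hp z c).1 hc'])
        simp [entry_one, this]

variable [BoundedGeometry X]

theorem extend_mul (S T : TranslationAlgebra X) :
    extend φ hφ hi (S * T) = extend φ hφ hi S * extend φ hφ hi T := by
  have hp := hi.isPartialInv
  ext a b
  rw [entry_extend]
  cases ha : Function.partialInv φ a with
  | none => simp [entry_mul, entry_extend, ha]
  | some x =>
    cases hb : Function.partialInv φ b with
    | none =>
      have : ∀ c, (extend φ hφ hi T).entry c b = 0 := fun c => by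
        rw [entry_extend, hb]
        cases Function.partialInv φ c <;> rfl
      simp [entry_mul, this]
    | some y =>
      obtain ⟨s, hs⟩ := S.exists_row_finset x
      change (S * T).entry x y = _
      rw [entry_mul_eq_sum S T x y s hs, entry_mul_eq_sum _ _ a b (s.map ⟨φ, hi⟩), Finset.sum_map]
      · simp [entry_extend, ha, hb, Function.partialInv_left hi]
      · intro c hc
        rw [entry_extend, ha] at hc
        cases hc' : Function.partialInv φ c with
        | none => simp [hc'] at hc
        | some z => exact Finset.mem_map.2 ⟨z, hs z (by simpa [hc'] using hc), (hp z c).1 hc'⟩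

/-- Extension by zero is a (non-unital) homomorphism of `*`-algebras. -/
def extendHom : TranslationAlgebra X →⋆ₙₐ[ℂ] TranslationAlgebra Z where
  toFun := extend φ hφ hi
  map_smul' c T := by
    ext a b
    simp only [entry_extend, entry_smul, MonoidHom.id_apply]
    cases Function.partialInv φ a <;> cases Function.partialInv φ b <;> simp
  map_zero' := by
    ext a b
    simp only [entry_extend]
    cases Function.partialInv φ a <;> cases Function.partialInv φ b <;> simp
  map_add' S T := by
    ext a b
    simp only [entry_extend, entry_add]
    cases Function.partialInv φ a <;> cases Function.partialInv φ b <;> simp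
  map_mul' := extend_mul hφ hi
  map_star' T := by
    ext a b
    simp only [entry_extend, entry_star]
    cases Function.partialInv φ a <;> cases Function.partialInv φ b <;> simp

end Extend

end TranslationAlgebra

section Corner

variable {A : Type*} [Ring A] [StarRing A] [Algebra ℂ A]
  {L : Type w} [NormedAddCommGroup L] [InnerProductSpace ℂ L] [CompleteSpace L]

open scoped InnerProductSpace

/-- The subspace on which a non-unital `*`-homomorphism acts non-degenerately: the range of the
projection `ϖ 1`. -/
def corner (ϖ : A →⋆ₙₐ[ℂ] (L →L[ℂ] L)) : Submodule ℂ L where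
  carrier := {ξ | ϖ 1 ξ = ξ}
  zero_mem' := map_zero _
  add_mem' := fun {ξ η} hξ hη => by
    change ϖ 1 (ξ + η) = ξ + η
    rw [map_add, hξ, hη]
  smul_mem' := fun c ξ hξ => by
    change ϖ 1 (c • ξ) = c • ξ
    rw [map_smul, hξ]

theorem mem_corner {ϖ : A →⋆ₙₐ[ℂ] (L →L[ℂ] L)} {ξ : L} : ξ ∈ corner ϖ ↔ ϖ 1 ξ = ξ := Iff.rfl

instance (ϖ : A →⋆ₙₐ[ℂ] (L →L[ℂ] L)) : CompleteSpace (corner ϖ) :=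
  (isClosed_eq (ϖ 1).continuous continuous_id).completeSpace_coe

theorem apply_mem_corner (ϖ : A →⋆ₙₐ[ℂ] (L →L[ℂ] L)) (a : A) (ξ : L) : ϖ a ξ ∈ corner ϖ := by
  rw [mem_corner, ← mul_apply_eq_comp, ← map_mul, one_mul]

/-- The unital `*`-homomorphism obtained by restricting to the corner. -/
def compress (ϖ : A →⋆ₙₐ[ℂ] (L →L[ℂ] L)) : A →⋆ₐ[ℂ] (corner ϖ →L[ℂ] corner ϖ) where
  toFun a := (ϖ a ∘L (corner ϖ).subtypeL).codRestrict (corner ϖ) fun ξ => apply_mem_corner ϖ a ξ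
  map_one' := by
    ext ξ
    exact ξ.2
  map_mul' a b := by
    ext ξ
    change ϖ (a * b) ξ = ϖ a (ϖ b ξ)
    rw [map_mul]; rfl
  map_zero' := by
    ext ξ
    change ϖ 0 ξ = 0
    rw [map_zero]; rfl
  map_add' a b := by
    ext ξ
    change ϖ (a + b) ξ = ϖ a ξ + ϖ b ξ
    rw [map_add]; rfl
  commutes' c := by
    ext ξ
    change ϖ (algebraMap ℂ A c) ξ = c • (ξ : L)
    rw [Algebra.algebraMap_eq_smul_one, map_smul]
    change c • ϖ 1 ξ = _
    rw [ξ.2]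
  map_star' a := by
    rw [ContinuousLinearMap.star_eq_adjoint, ContinuousLinearMap.eq_adjoint_iff]
    intro ξ η
    change ⟪ϖ (star a) ξ, (η : L)⟫_ℂ = ⟪(ξ : L), ϖ a η⟫_ℂ
    rw [map_star, ContinuousLinearMap.star_eq_adjoint, ContinuousLinearMap.adjoint_inner_left]

theorem coe_compress_apply (ϖ : A →⋆ₙₐ[ℂ] (L →L[ℂ] L)) (a : A) (ξ : corner ϖ) :
    (compress ϖ a ξ : L) = ϖ a ξ := rfl

end Corner

section Amplify

variable {Y : Type v} [CoarseSpace Y] {n : ℕ}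

/-- The `(i, j)` block of a matrix over `n` copies of `Y`. -/
def TranslationAlgebra.block (i j : Fin n) (T : TranslationAlgebra (Y × Fin n)) :
    TranslationAlgebra Y :=
  T.reindex (fun y => (y, i)) (fun y => (y, j)) fun E hE => by
    obtain ⟨F, hF, h⟩ := hE
    exact CoarseSpace.subset hF fun p hp => h (p.1, i) (p.2, j) hp

theorem TranslationAlgebra.entry_block (i j : Fin n) (T : TranslationAlgebra (Y × Fin n))
    (x y : Y) : (T.block i j).entry x y = T.entry (x, i) (y, j) := rfl

variable [BoundedGeometry Y]

theorem TranslationAlgebra.block_mul (i j : Fin n) (S T : TranslationAlgebra (Y × Fin n)) :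
    (S * T).block i j = ∑ k, S.block i k * T.block k j := by
  classical
  ext x y
  obtain ⟨s, hs⟩ := S.exists_row_finset (x, i)
  rw [entry_block, entry_sum, entry_mul_eq_sum S T _ _ (s.image Prod.fst ×ˢ Finset.univ) fun z hz =>
    Finset.mem_product.2 ⟨Finset.mem_image_of_mem _ (hs z hz), Finset.mem_univ _⟩,
    Finset.sum_product_right]
  refine Finset.sum_congr rfl fun k _ => ?_
  rw [entry_mul_eq_sum _ _ x y (s.image Prod.fst) fun z hz =>
    Finset.mem_image_of_mem Prod.fst (hs (z, k) hz)]
  rfl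

variable {K : Type w} [NormedAddCommGroup K] [InnerProductSpace ℂ K] [CompleteSpace K]

open scoped InnerProductSpace

/-- The operator on the sum of `n` copies of `K` given by the blocks of a matrix. -/
def amplifyOp (ρ : Representation Y K) (T : TranslationAlgebra (Y × Fin n)) :
    (PiLp 2 fun _ : Fin n => K) →L[ℂ] PiLp 2 fun _ : Fin n => K :=
  (PiLp.continuousLinearEquiv 2 ℂ fun _ : Fin n => K).symm.toContinuousLinearMap ∘L
    ContinuousLinearMap.pi fun i => ∑ j, ρ (T.block i j) ∘L PiLp.proj 2 (fun _ : Fin n => K) j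

theorem amplifyOp_apply (ρ : Representation Y K) (T : TranslationAlgebra (Y × Fin n))
    (η : PiLp 2 fun _ : Fin n => K) (i : Fin n) :
    amplifyOp ρ T η i = ∑ j, ρ (T.block i j) (η j) := by
  change (∑ j, ρ (T.block i j) ∘L PiLp.proj 2 (fun _ : Fin n => K) j) η = _
  rw [sum_apply]
  rfl

theorem amplifyOp_smul_one (ρ : Representation Y K) (c : ℂ) :
    amplifyOp ρ (c • 1 : TranslationAlgebra (Y × Fin n)) = c • 1 := by
  classical
  have h : ∀ i j : Fin n, (c • 1 : TranslationAlgebra (Y × Fin n)).block i j =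
      if i = j then c • 1 else 0 := fun i j => by
    ext x y
    rw [TranslationAlgebra.entry_block, TranslationAlgebra.entry_smul,
      TranslationAlgebra.entry_one]
    by_cases hij : i = j <;> simp [hij, TranslationAlgebra.entry_one]
  ext η i
  rw [amplifyOp_apply, Finset.sum_eq_single i]
  · rw [h, if_pos rfl, map_smul, map_one]; rfl
  · intro j _ hj
    rw [h, if_neg hj.symm, map_zero]; rfl
  · simp

/-- The representation of the translation algebra of `n` copies of `Y`, an algebra of `n × n`
matrices, on the sum of `n` copies of a representation of the translation algebra of `Y`. -/
def amplify (n : ℕ) (ρ : Representation Y K) :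
    Representation (Y × Fin n) (PiLp 2 fun _ : Fin n => K) where
  toFun := amplifyOp ρ
  map_one' := by simpa using amplifyOp_smul_one (n := n) ρ 1
  map_mul' S T := by
    ext η i
    change _ = amplifyOp ρ S (amplifyOp ρ T η) i
    simp only [amplifyOp_apply, TranslationAlgebra.block_mul, map_sum, sum_apply, ρ.mul_apply]
    rw [Finset.sum_comm]
  map_zero' := by
    ext η i
    have : ∀ j, (0 : TranslationAlgebra (Y × Fin n)).block i j = 0 := fun j => rfl
    simp [amplifyOp_apply, this]
  map_add' S T := by
    ext η i
    change _ = amplifyOp ρ S η i + amplifyOp ρ T η i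
    have : ∀ j, (S + T).block i j = S.block i j + T.block i j := fun j => rfl
    simp only [amplifyOp_apply, this, map_add, add_apply, Finset.sum_add_distrib]
  commutes' c := by
    rw [Algebra.algebraMap_eq_smul_one, amplifyOp_smul_one, Algebra.algebraMap_eq_smul_one]
  map_star' T := by
    rw [ContinuousLinearMap.star_eq_adjoint, ContinuousLinearMap.eq_adjoint_iff]
    intro ξ η
    have : ∀ i j, (star T).block i j = star (T.block j i) := fun i j => rfl
    simp only [PiLp.inner_apply, amplifyOp_apply, sum_inner, inner_sum, this, ρ.inner_map_star]
    rw [Finset.sum_comm]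

theorem amplify_apply (ρ : Representation Y K) (T : TranslationAlgebra (Y × Fin n))
    (η : PiLp 2 fun _ : Fin n => K) (i : Fin n) :
    amplify n ρ T η i = ∑ j, ρ (T.block i j) (η j) :=
  amplifyOp_apply ρ T η i

end Amplify

/-! ### Elementary computations of row sums and entries -/

open scoped InnerProductSpace

theorem TranslationAlgebra.rowSum_one {X : Type u} [CoarseSpace X] (x : X) :
    (1 : TranslationAlgebra X).rowSum x = 1 := by
  classical
  rw [rowSum, finsum_eq_single _ x fun y hy => by simp [entry_one, hy.symm]]
  simp [entry_one]

theorem TranslationAlgebra.rowSum_mul_of_rowSum_eq_one {X : Type u} [CoarseSpace X]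
    [BoundedGeometry X] {S T : TranslationAlgebra X} {x : X}
    (h : ∀ z, S.entry x z ≠ 0 → T.rowSum z = 1) : (S * T).rowSum x = S.rowSum x := by
  rw [rowSum_mul]
  refine finsum_congr fun z => ?_
  by_cases hz : S.entry x z = 0
  · simp [hz]
  · rw [h z hz, mul_one]

theorem TranslationAlgebra.entry_mul_eq_zero {X : Type u} [CoarseSpace X]
    [BoundedGeometry X] (S : TranslationAlgebra X) {T : TranslationAlgebra X} {y : X}
    (h : ∀ z, T.entry z y = 0) (x : X) : (S * T).entry x y = 0 := by
  simp [entry_mul, h]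

/-! ### Invariant vectors of a corner -/

section Corner

variable {X : Type u} {Z : Type v} [CoarseSpace X] [CoarseSpace Z] [BoundedGeometry X]
  [BoundedGeometry Z] {L : Type w} [NormedAddCommGroup L] [InnerProductSpace ℂ L] [CompleteSpace L]
  {φ : X → Z} (hφ : UniformlyExpansive φ) (hi : Function.Injective φ)

/-- A representation of the translation algebra of `Z`, restricted to that of a subspace `X`; the
unit of the latter acts as a projection. -/
def restrictHom (ϖ : Representation Z L) : TranslationAlgebra X →⋆ₙₐ[ℂ] (L →L[ℂ] L) :=
  (ϖ : TranslationAlgebra Z →⋆ₙₐ[ℂ] (L →L[ℂ] L)).comp (TranslationAlgebra.extendHom hφ hi)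

theorem restrictHom_apply (ϖ : Representation Z L) (T : TranslationAlgebra X) :
    restrictHom hφ hi ϖ T = ϖ (T.extend φ hφ hi) := rfl

/-- A vector which is invariant for the subspace `X` of `Z` is annihilated by all matrices over `Z`
whose columns are indexed by `X` and whose rows sum to zero. The rows may be indexed by all of `Z`,
since `U* U` is a matrix over `X`. -/
theorem apply_eq_zero_of_mem_constantVectors_compress
    (hc : ∀ E : SetRel Z Z, CoarseSpace.IsControlled E →
      CoarseSpace.IsControlled ({p | (φ p.1, φ p.2) ∈ E} : SetRel X X))
    (ϖ : Representation Z L) {η : corner (restrictHom hφ hi ϖ)}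
    (hη : η ∈ constantVectors (compress (restrictHom hφ hi ϖ))) {U : TranslationAlgebra Z}
    (h0 : ∀ a, U.rowSum a = 0) (hU : ∀ b, b ∉ Set.range φ → ∀ a, U.entry a b = 0) :
    ϖ U (η : L) = 0 := by
  have hQ : ((star U * U).reindex φ φ hc).extend φ hφ hi = star U * U := by
    refine TranslationAlgebra.extend_reindex hφ hi hc (fun a ha b => ?_) fun b hb a => ?_
    · rw [TranslationAlgebra.entry_mul]
      simp [hU a ha]
    · exact TranslationAlgebra.entry_mul_eq_zero _ (hU b hb) a
  have hrow : ∀ x, ((star U * U).reindex φ φ hc).rowSum x = 0 := fun x => by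
    rw [← TranslationAlgebra.rowSum_extend hφ hi, hQ]
    exact TranslationAlgebra.rowSum_mul_eq_zero _ h0 _
  have h1 := congrArg Subtype.val (apply_eq_zero_of_mem_constantVectors hη hrow)
  rw [coe_compress_apply, restrictHom_apply, hQ, ϖ.mul_apply] at h1
  have h2 : ⟪ϖ U (η : L), ϖ U (η : L)⟫_ℂ = 0 := by
    rw [← ϖ.inner_map_star, h1]
    simp
  exact inner_self_eq_zero.1 h2

end Corner

/-! ### Coarse equivalences -/

section Equivalence

variable {X : Type u} {Y : Type v} [CoarseSpace X] [CoarseSpace Y]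

theorem CoarselyEquivalent.symm (h : CoarselyEquivalent X Y) : CoarselyEquivalent Y X := by
  obtain ⟨f, g, hf, hg, hfg, hgf⟩ := h
  exact ⟨g, f, hg, hf, hgf, hfg⟩

/-- A coarse equivalence is a coarse embedding. -/
theorem isControlled_preimage {f : X → Y} {g : Y → X} (hg : UniformlyExpansive g)
    (hgf : Close (g ∘ f) id) {F : SetRel Y Y} (hF : CoarseSpace.IsControlled F) :
    CoarseSpace.IsControlled ({p | (f p.1, f p.2) ∈ F} : SetRel X X) := by
  refine CoarseSpace.subset
    (CoarseSpace.comp (CoarseSpace.comp (CoarseSpace.inv hgf) (hg F hF)) hgf) ?_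
  rintro ⟨x, x'⟩ h
  exact ⟨g (f x'), ⟨g (f x), ⟨x, rfl⟩, ⟨f x, f x', h, rfl⟩⟩, ⟨x', rfl⟩⟩

/-- The fibres of a coarse embedding are uniformly bounded, so that its domain embeds into finitely
many copies of the codomain. -/
theorem exists_injective_prod [BoundedGeometry X] {f : X → Y} {g : Y → X}
    (hg : UniformlyExpansive g) (hgf : Close (g ∘ f) id) :
    ∃ (N : ℕ) (c : X → Fin (N + 1)), Function.Injective fun x => (f x, c x) := by
  obtain ⟨M, hM⟩ := BoundedGeometry.exists_bound _
    (isControlled_preimage hg hgf CoarseSpace.diagonal)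
  have hfib : ∀ y, (f ⁻¹' {y}).encard ≤ M := fun y => by
    rcases (f ⁻¹' {y}).eq_empty_or_nonempty with h | ⟨x, hx⟩
    · simp [h]
    · refine (Set.encard_le_encard fun x' hx' => ?_).trans (hM x)
      exact Or.inl ((show f x = y from hx).trans (show f x' = y from hx').symm)
  choose c hc using fun y => exists_injOn_fin (hfib y)
  refine ⟨M, fun x => c (f x) x, fun x x' h => ?_⟩
  obtain ⟨h1, h2⟩ := Prod.ext_iff.1 h
  dsimp only at h1 h2
  rw [← h1] at h2
  exact hc (f x) rfl h1.symm h2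

end Equivalence

theorem injective_prodMk_zero {Y : Type v} {N : ℕ} :
    Function.Injective fun y : Y => (y, (0 : Fin (N + 1))) :=
  fun _ _ h => congrArg Prod.fst h

section Embeddings

variable {X : Type u} {Y : Type v} [CoarseSpace Y] {N : ℕ} {f : X → Y} {g : Y → X}
  {c : X → Fin (N + 1)}

/-- Composition with `f`, as a matrix over `N + 1` copies of `Y`: the space `X` is embedded by
`x ↦ (f x, c x)`, and `Y` by `y ↦ (y, 0)`. -/
def pullOp (f : X → Y) (c : X → Fin (N + 1)) (hi : Function.Injective fun x => (f x, c x)) :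
    TranslationAlgebra (Y × Fin (N + 1)) :=
  TranslationAlgebra.partialMapOp
    (fun a => (Function.partialInv (fun x => (f x, c x)) a).map fun x => (f x, 0))
    ⟨SetRel.id, CoarseSpace.diagonal, fun a b h => by
      obtain ⟨x, hx, rfl⟩ := Option.map_eq_some_iff.1 h
      have := (hi.isPartialInv x a).1 hx
      exact (congrArg Prod.fst this).symm⟩

/-- Composition with `g`, as a matrix over `N + 1` copies of `Y`: the space `X` is embedded by
`x ↦ (f x, c x)`, and `Y` by `y ↦ (y, 0)`. -/
def inversePullOp (f : X → Y) (c : X → Fin (N + 1)) {g : Y → X} (hfg : Close (f ∘ g) id) :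
    TranslationAlgebra (Y × Fin (N + 1)) :=
  TranslationAlgebra.partialMapOp
    (fun a => if a.2 = 0 then some (f (g a.1), c (g a.1)) else none)
    ⟨_, CoarseSpace.inv hfg, fun a b h => by
      change (if a.2 = 0 then some (f (g a.1), c (g a.1)) else none) = some b at h
      split_ifs at h
      obtain rfl := Option.some_inj.1 h
      exact ⟨a.1, rfl⟩⟩

section

variable (hi : Function.Injective fun x => (f x, c x)) (hfg : Close (f ∘ g) id)

theorem rowSum_pullOp (x : X) : (pullOp f c hi).rowSum (f x, c x) = 1 := by
  rw [pullOp, TranslationAlgebra.rowSum_partialMapOp]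
  have := Function.partialInv_left hi x
  simp [this]

theorem entry_pullOp_of_notMem {a : Y × Fin (N + 1)} (ha : a ∉ Set.range fun x => (f x, c x))
    (b : Y × Fin (N + 1)) : (pullOp f c hi).entry a b = 0 := by
  rw [pullOp, TranslationAlgebra.entry_partialMapOp, if_neg]
  intro h
  obtain ⟨x, hx, -⟩ := Option.map_eq_some_iff.1 h
  exact ha ⟨x, (hi.isPartialInv x a).1 hx⟩

theorem entry_pullOp_of_ne (a : Y × Fin (N + 1)) {b : Y × Fin (N + 1)} (hb : b.2 ≠ 0) :
    (pullOp f c hi).entry a b = 0 := by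
  rw [pullOp, TranslationAlgebra.entry_partialMapOp, if_neg]
  intro h
  obtain ⟨x, hx, rfl⟩ := Option.map_eq_some_iff.1 h
  exact hb rfl

theorem norm_entry_pullOp_le (a b : Y × Fin (N + 1)) : ‖(pullOp f c hi).entry a b‖ ≤ 1 := by
  rw [pullOp, TranslationAlgebra.entry_partialMapOp]
  split_ifs <;> simp

theorem rowSum_inversePullOp (y : Y) : (inversePullOp f c hfg).rowSum (y, 0) = 1 := by
  simp [inversePullOp, TranslationAlgebra.rowSum_partialMapOp]

theorem entry_inversePullOp_of_ne {a : Y × Fin (N + 1)} (ha : a.2 ≠ 0) (b : Y × Fin (N + 1)) :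
    (inversePullOp f c hfg).entry a b = 0 := by
  simp [inversePullOp, TranslationAlgebra.entry_partialMapOp, ha]

theorem entry_inversePullOp_of_notMem (a : Y × Fin (N + 1)) {b : Y × Fin (N + 1)}
    (hb : b ∉ Set.range fun x => (f x, c x)) : (inversePullOp f c hfg).entry a b = 0 := by
  rw [inversePullOp, TranslationAlgebra.entry_partialMapOp, if_neg]
  intro h
  split_ifs at h
  exact hb ⟨_, Option.some_inj.1 h⟩

theorem uniformlyExpansive_prod [CoarseSpace X] (hf : UniformlyExpansive f) :
    UniformlyExpansive fun x => (f x, c x) := fun E hE => by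
  refine ⟨_, hf E hE, ?_⟩
  rintro a b ⟨x, x', hx, h⟩
  obtain ⟨rfl, rfl⟩ := Prod.ext_iff.1 h
  exact ⟨x, x', hx, rfl⟩

end

/-! ### Blocks in the zeroth copy -/

theorem uniformlyExpansive_prodMk_zero :
    UniformlyExpansive fun y : Y => (y, (0 : Fin (N + 1))) := fun E hE => by
  refine ⟨E, hE, ?_⟩
  rintro a b ⟨x, x', hx, h⟩
  obtain ⟨rfl, rfl⟩ := Prod.ext_iff.1 h
  exact hx

theorem TranslationAlgebra.rowSum_block_zero [BoundedGeometry Y]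
    {T : TranslationAlgebra (Y × Fin (N + 1))}
    (hT : ∀ a b : Y × Fin (N + 1), b.2 ≠ 0 → T.entry a b = 0) (i : Fin (N + 1)) (y : Y) :
    (T.block i 0).rowSum y = T.rowSum (y, i) := by
  obtain ⟨s, hs⟩ := (T.block i 0).exists_row_finset y
  rw [rowSum_eq_sum _ y s hs, rowSum_eq_sum T (y, i) (s.map ⟨_, injective_prodMk_zero⟩),
    Finset.sum_map]
  · rfl
  · rintro ⟨z, j⟩ hz
    obtain rfl : j = 0 := not_not.1 fun hj => hz (hT _ _ hj)
    exact Finset.mem_map.2 ⟨z, hs z hz, rfl⟩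

variable [BoundedGeometry Y] {K : Type w} [NormedAddCommGroup K] [InnerProductSpace ℂ K]
  [CompleteSpace K]

theorem amplify_apply_single (ρ : Representation Y K)
    (T : TranslationAlgebra (Y × Fin (N + 1))) (ξ : K) (i : Fin (N + 1)) :
    amplify (N + 1) ρ T (PiLp.single 2 0 ξ) i = ρ (T.block i 0) ξ := by
  rw [amplify_apply, Finset.sum_eq_single 0]
  · rw [PiLp.single_eq_same]
  · intro j _ hj
    rw [PiLp.single_eq_of_ne _ hj, map_zero]
  · simp

theorem amplify_extend_apply_zero (ρ : Representation Y K) (T : TranslationAlgebra Y)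
    (η : PiLp 2 fun _ : Fin (N + 1) => K) :
    amplify (N + 1) ρ (T.extend _ uniformlyExpansive_prodMk_zero injective_prodMk_zero) η 0 =
      ρ T (η 0) := by
  have hp := (injective_prodMk_zero (Y := Y) (N := N)).isPartialInv
  rw [amplify_apply, Finset.sum_eq_single 0]
  · congr 2
    ext x y
    rw [TranslationAlgebra.entry_block]
    exact TranslationAlgebra.entry_extend_apply _ _ T x y
  · intro j _ hj
    have : (T.extend _ uniformlyExpansive_prodMk_zero injective_prodMk_zero).block 0 j = 0 := by
      ext x y
      rw [TranslationAlgebra.entry_block, TranslationAlgebra.entry_extend]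
      cases h : Function.partialInv (fun y : Y => (y, (0 : Fin (N + 1)))) (y, j) with
      | none => cases Function.partialInv (fun y : Y => (y, (0 : Fin (N + 1)))) (x, 0) <;> rfl
      | some z => exact absurd (congrArg Prod.snd ((hp _ _).1 h)).symm hj
    rw [this, map_zero]; rfl
  · simp

end Embeddings

/-! ### Transfer of property (T) -/

section Transfer

variable {X : Type u} {Y : Type v} [CoarseSpace Y] [BoundedGeometry Y] {N : ℕ} {f : X → Y}
  {g : Y → X} {c : X → Fin (N + 1)}

/-- Pull-backs to the induced representation are bounded below on almost invariant vectors, since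
pulling back along `f` and then along `g` is close to the identity. -/
theorem exists_norm_le_norm_pullOp {E : SetRel Y Y} (hE : IsGenerating E)
    (hfg : Close (f ∘ g) id) (hi : Function.Injective fun x => (f x, c x)) :
    ∃ κ R : ℝ, 0 ≤ κ ∧ 0 ≤ R ∧
      ∀ (K : Type w) [NormedAddCommGroup K] [InnerProductSpace ℂ K] [CompleteSpace K]
        (ρ : Representation Y K) (ξ : K) (δ : ℝ), AlmostInvariant ρ E δ ξ →
        ‖ξ‖ ≤ κ * δ + R * ‖amplify (N + 1) ρ (pullOp f c hi) (PiLp.single 2 0 ξ)‖ := by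
  set V := pullOp f c hi with hV
  set W := inversePullOp f c hfg with hW
  obtain ⟨R, hR, hWR⟩ := Representation.exists_norm_apply_le.{v, w} W
  set Q := (W * V).block 0 0 with hQ
  obtain ⟨C, hC⟩ := (1 - Q).exists_bound
  obtain ⟨κ, hκ, h⟩ := hE.exists_norm_apply_le.{v, w} (1 - Q).controlled_supp (le_max_right C 0)
  refine ⟨κ, R, hκ, hR, fun K _ _ _ ρ ξ δ hδ => ?_⟩
  have h1 := h K ρ ξ δ hδ (1 - Q) subset_rfl (fun x y => (hC x y).trans (le_max_left _ _))
    fun y => by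
      rw [TranslationAlgebra.rowSum_sub, TranslationAlgebra.rowSum_one, hQ,
        TranslationAlgebra.rowSum_block_zero, TranslationAlgebra.rowSum_mul_of_rowSum_eq_one,
        rowSum_inversePullOp, sub_self]
      · intro z hz
        have hz' : z ∈ Set.range fun x => (f x, c x) := by
          by_contra h
          exact hz (entry_inversePullOp_of_notMem hfg _ h)
        obtain ⟨x, rfl⟩ := hz'
        exact rowSum_pullOp hi x
      · intro a b hb
        exact TranslationAlgebra.entry_mul_eq_zero _ (fun z => entry_pullOp_of_ne hi z hb) a
  have h2 : ‖ρ Q ξ‖ ≤ R * ‖amplify (N + 1) ρ V (PiLp.single 2 0 ξ)‖ := by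
    rw [hQ, ← amplify_apply_single, Representation.mul_apply]
    exact (PiLp.norm_apply_le _ _).trans (hWR _ _ _)
  calc ‖ξ‖ = ‖ρ (1 - Q) ξ + ρ Q ξ‖ := by simp
    _ ≤ _ := (norm_add_le _ _).trans (add_le_add h1 h2)

variable [CoarseSpace X] [BoundedGeometry X] {K : Type w} [NormedAddCommGroup K]
  [InnerProductSpace ℂ K] [CompleteSpace K]

/-- The representation of the translation algebra of `X` obtained from one of the translation
algebra of `Y` by amplification and restriction to a corner. -/
abbrev inducedHom (hf : UniformlyExpansive f) (hi : Function.Injective fun x => (f x, c x))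
    (ρ : Representation Y K) :
    TranslationAlgebra X →⋆ₙₐ[ℂ] ((PiLp 2 fun _ : Fin (N + 1) => K) →L[ℂ]
      PiLp 2 fun _ : Fin (N + 1) => K) :=
  restrictHom (uniformlyExpansive_prod (c := c) hf) hi (amplify (N + 1) ρ)

/-- Invariant vectors of the induced representation are pull-backs of invariant vectors. -/
theorem exists_mem_constantVectors_pullOp (hf : UniformlyExpansive f) (hg : UniformlyExpansive g)
    (hfg : Close (f ∘ g) id) (hgf : Close (g ∘ f) id)
    (hi : Function.Injective fun x => (f x, c x)) (ρ : Representation Y K)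
    {η : corner (inducedHom hf hi ρ)} (hη : η ∈ constantVectors (compress (inducedHom hf hi ρ))) :
    ∃ ζ ∈ constantVectors ρ,
      amplify (N + 1) ρ (pullOp f c hi) (PiLp.single 2 0 ζ) =
        (η : PiLp 2 fun _ : Fin (N + 1) => K) := by
  have hc : ∀ E : SetRel (Y × Fin (N + 1)) (Y × Fin (N + 1)), CoarseSpace.IsControlled E →
      CoarseSpace.IsControlled ({p | ((f p.1, c p.1), (f p.2, c p.2)) ∈ E} : SetRel X X) := by
    rintro E ⟨F, hF, h⟩
    exact CoarseSpace.subset (isControlled_preimage hg hgf hF) fun p hp => h _ _ hp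
  set ϖ := amplify (N + 1) ρ with hϖ
  set W := inversePullOp f c hfg with hW
  have hsingle : PiLp.single 2 0 (ϖ W η 0) = ϖ W η := by
    ext i
    by_cases h : i = 0
    · subst h; rw [PiLp.single_eq_same]
    · rw [PiLp.single_eq_of_ne _ h, hϖ, amplify_apply]
      have : ∀ j, W.block i j = 0 := fun j => by
        ext x y
        exact entry_inversePullOp_of_ne hfg h _
      simp [this]
  refine ⟨ϖ W η 0, mem_constantVectors_iff.2 fun t => ?_, ?_⟩
  · rw [← amplify_extend_apply_zero (N := N), ← hϖ, ← ϖ.mul_apply,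
      apply_eq_zero_of_mem_constantVectors_compress _ hi hc ϖ hη]
    · rfl
    · intro a
      rw [TranslationAlgebra.rowSum_mul_of_rowSum_eq_one]
      · by_cases ha : a ∈ Set.range fun y : Y => (y, (0 : Fin (N + 1)))
        · obtain ⟨y, rfl⟩ := ha
          rw [TranslationAlgebra.rowSum_extend, t.rowSum_defect]
        · exact TranslationAlgebra.rowSum_extend_of_notMem _ _ _ ha
      · rintro ⟨z, j⟩ hz
        have hj : (z, j) ∈ Set.range fun y : Y => (y, (0 : Fin (N + 1))) := by
          by_contra h
          exact hz (TranslationAlgebra.entry_extend_of_notMem _ _ _ _ h)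
        obtain ⟨y, hy⟩ := hj
        rw [← hy]
        exact rowSum_inversePullOp hfg y
    · intro b hb
      exact TranslationAlgebra.entry_mul_eq_zero _ fun z => entry_inversePullOp_of_notMem hfg z hb
  · rw [hsingle, ← ϖ.mul_apply, ← sub_eq_zero]
    have h1 : ϖ (TranslationAlgebra.extend _ (uniformlyExpansive_prod hf) hi 1)
        (η : PiLp 2 fun _ : Fin (N + 1) => K) = η := η.2
    nth_rewrite 2 [← h1]
    rw [← sub_apply, ← map_sub]
    refine apply_eq_zero_of_mem_constantVectors_compress _ hi hc ϖ hη (fun a => ?_)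
      fun b hb a => ?_
    · rw [TranslationAlgebra.rowSum_sub, TranslationAlgebra.rowSum_mul_of_rowSum_eq_one]
      · by_cases ha : a ∈ Set.range fun x => (f x, c x)
        · obtain ⟨x, rfl⟩ := ha
          rw [TranslationAlgebra.rowSum_extend (uniformlyExpansive_prod hf) hi,
            TranslationAlgebra.rowSum_one, rowSum_pullOp, sub_self]
        · rw [TranslationAlgebra.rowSum_extend_of_notMem _ _ _ ha, sub_zero,
            TranslationAlgebra.rowSum]
          simp [entry_pullOp_of_notMem hi ha]
      · rintro ⟨z, j⟩ hz
        obtain rfl : j = 0 := not_not.1 fun hj => hz (entry_pullOp_of_ne hi _ hj)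
        exact rowSum_inversePullOp hfg z
    · rw [TranslationAlgebra.entry_sub,
        TranslationAlgebra.entry_mul_eq_zero _ fun z => entry_inversePullOp_of_notMem hfg z hb,
        TranslationAlgebra.entry_extend_of_notMem _ _ _ _ hb, sub_self]

/-- Pull-backs of almost invariant vectors are almost invariant. -/
theorem exists_almostInvariant_pullOp {E : SetRel Y Y} (hE : IsGenerating E)
    (hf : UniformlyExpansive f) (hi : Function.Injective fun x => (f x, c x)) {F : SetRel X X}
    (hF : CoarseSpace.IsControlled F) :
    ∃ κ : ℝ, 0 ≤ κ ∧
      ∀ (K : Type w) [NormedAddCommGroup K] [InnerProductSpace ℂ K] [CompleteSpace K]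
        (ρ : Representation Y K) (ξ : K) (δ : ℝ), AlmostInvariant ρ E δ ξ →
        ∀ t : PartialTranslation X, t.op.supp ⊆ F →
        ‖inducedHom hf hi ρ t.defect
          (amplify (N + 1) ρ (pullOp f c hi) (PiLp.single 2 0 ξ))‖ ≤ κ * δ := by
  set V := pullOp f c hi with hV
  have hφ := uniformlyExpansive_prod (c := c) hf
  have hF1 := hφ _ (CoarseSpace.union CoarseSpace.diagonal hF)
  obtain ⟨M, hM⟩ := TranslationAlgebra.exists_norm_entry_mul_le hF1
  obtain ⟨F', hF', hsub⟩ := CoarseSpace.comp hF1 V.controlled_supp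
  obtain ⟨κ, hκ, h⟩ := hE.exists_norm_apply_le.{v, w} hF' (C := M * (2 * 1)) (by positivity)
  refine ⟨(N + 1) * κ, by positivity, fun K _ _ _ ρ ξ δ hδ t ht => ?_⟩
  set T := t.defect.extend _ hφ hi with hT
  have hTF : T.supp ⊆ {p | ∃ x₁ x₂, (x₁, x₂) ∈ SetRel.id ∪ F ∧
      p = ((f x₁, c x₁), (f x₂, c x₂))} := by
    rintro ⟨a, b⟩ hab
    have ha : a ∈ Set.range fun x => (f x, c x) := by
      by_contra h
      refine hab ?_
      change T.entry a b = 0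
      rw [hT, TranslationAlgebra.entry_extend_of_notMem_left _ _ _ h]
    have hb : b ∈ Set.range fun x => (f x, c x) := by
      by_contra h
      exact hab (TranslationAlgebra.entry_extend_of_notMem _ _ _ _ h)
    obtain ⟨x, rfl⟩ := ha
    obtain ⟨y, rfl⟩ := hb
    refine ⟨x, y, ?_, rfl⟩
    have : (x, y) ∈ t.defect.supp := by
      rw [TranslationAlgebra.mem_supp, ← TranslationAlgebra.entry_extend_apply hφ hi]
      exact hab
    exact (t.supp_defect_subset this).imp id fun h => ht h
  have hT2 : ∀ a b, ‖T.entry a b‖ ≤ 2 := fun a b => by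
    rw [hT, TranslationAlgebra.entry_extend]
    cases Function.partialInv (fun x => (f x, c x)) a with
    | none => simp
    | some x =>
      cases Function.partialInv (fun x => (f x, c x)) b with
      | none => simp
      | some y => exact t.norm_entry_defect_le x y
  have hcoord : ∀ i, ‖amplify (N + 1) ρ (T * V) (PiLp.single 2 0 ξ) i‖ ≤ κ * δ := fun i => by
    rw [amplify_apply_single]
    refine h K ρ ξ δ hδ _ ?_ (fun x y => hM T V 2 1 hTF hT2 (norm_entry_pullOp_le hi) _ _) ?_
    · rintro ⟨x, y⟩ hxy
      exact hsub (x, i) (y, 0) (TranslationAlgebra.supp_mul_subset hTF subset_rfl hxy)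
    · intro y
      rw [TranslationAlgebra.rowSum_block_zero fun a b hb =>
        TranslationAlgebra.entry_mul_eq_zero _ (fun z => entry_pullOp_of_ne hi z hb) a,
        TranslationAlgebra.rowSum_mul_of_rowSum_eq_one]
      · by_cases ha : (y, i) ∈ Set.range fun x => (f x, c x)
        · obtain ⟨x, hx⟩ := ha
          rw [← hx, hT, TranslationAlgebra.rowSum_extend hφ hi, t.rowSum_defect]
        · exact TranslationAlgebra.rowSum_extend_of_notMem _ _ _ ha
      · intro z hz
        have hz' : z ∈ Set.range fun x => (f x, c x) := by
          by_contra h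
          exact hz (TranslationAlgebra.entry_extend_of_notMem _ _ _ _ h)
        obtain ⟨x, rfl⟩ := hz'
        exact rowSum_pullOp hi x
  rw [restrictHom_apply, ← Representation.mul_apply, ← hT]
  have hκδ : 0 ≤ κ * δ := (norm_nonneg _).trans (hcoord 0)
  refine abs_le_of_sq_le_sq' ?_ (by rw [mul_assoc]; positivity) |>.2
  rw [PiLp.norm_sq_eq_of_L2]
  calc ∑ i, ‖amplify (N + 1) ρ (T * V) (PiLp.single 2 0 ξ) i‖ ^ 2
      ≤ ∑ _i : Fin (N + 1), (κ * δ) ^ 2 :=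
        Finset.sum_le_sum fun i _ => pow_le_pow_left₀ (norm_nonneg _) (hcoord i) 2
    _ = (N + 1) * (κ * δ) ^ 2 := by simp
    _ ≤ (N + 1) ^ 2 * (κ * δ) ^ 2 := by
        gcongr
        exact le_self_pow₀ (by linarith [Nat.cast_nonneg (α := ℝ) N]) two_ne_zero
    _ = ((N + 1) * κ * δ) ^ 2 := by ring

end Transfer

theorem GeometricPropertyT.of_coarselyEquivalent {X : Type u} {Y : Type v} [CoarseSpace X]
    [CoarseSpace Y] [BoundedGeometry X] [BoundedGeometry Y] [Monogenic X]
    (h : CoarselyEquivalent X Y) (hX : GeometricPropertyT.{u, w} X) :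
    GeometricPropertyT.{v, w} Y := by
  obtain ⟨f, g, hf, hg, hfg, hgf⟩ := h
  obtain ⟨N, c, hi⟩ := exists_injective_prod hg hgf
  obtain ⟨F, hF⟩ := Monogenic.exists_generating (X := X)
  obtain ⟨a, ha, hX⟩ := hX F hF
  intro E hE
  obtain ⟨κ, R, hκ, hR, hlow⟩ := exists_norm_le_norm_pullOp.{u, v, w} hE hfg hi
  obtain ⟨μ, hμ, hup⟩ := exists_almostInvariant_pullOp.{u, v, w} hE hf hi hF.1
  -- the constant has to satisfy `κ b < 1` and `2 μ R b < a`, up to factors of `2`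
  have hμR : 0 ≤ 2 * μ * R := by positivity
  obtain ⟨b, hb, hb1, hb2⟩ : ∃ b : ℝ, 0 < b ∧ κ * b ≤ 1 / 2 ∧ 2 * μ * R * b ≤ a / 2 := by
    refine ⟨min (1 / (2 * (κ + 1))) (a / (2 * (2 * μ * R + 1))), by positivity, ?_, ?_⟩
    · calc κ * min (1 / (2 * (κ + 1))) (a / (2 * (2 * μ * R + 1)))
          ≤ (κ + 1) * (1 / (2 * (κ + 1))) := by
            gcongr
            · linarith
            · exact min_le_left _ _
        _ = 1 / 2 := by field_simp
    · calc 2 * μ * R * min (1 / (2 * (κ + 1))) (a / (2 * (2 * μ * R + 1)))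
          ≤ (2 * μ * R + 1) * (a / (2 * (2 * μ * R + 1))) := by
            gcongr
            · linarith
            · exact min_le_right _ _
        _ = a / 2 := by field_simp
  refine ⟨b, hb, fun K _ _ _ ρ ξ hξ => ?_⟩
  by_contra! hcon
  -- the empty partial translation
  have hξ0 : 0 < ‖ξ‖ := by
    let t : PartialTranslation Y := PartialTranslation.ofMatching ∅
      (CoarseSpace.subset hE.1 (Set.empty_subset _)) (by simp) (by simp)
    have := hcon t (by
      rintro ⟨x, y⟩ h
      rw [PartialTranslation.mem_supp_op, PartialTranslation.ofMatching_eq_some] at h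
      simp at h)
    exact pos_of_mul_pos_right ((norm_nonneg _).trans_lt this) hb.le
  let σ := inducedHom hf hi ρ
  let π : Representation X (corner σ) := compress σ
  have hclosed := isClosed_constantVectors π
  have : CompleteSpace (constantVectors π) := hclosed.completeSpace_coe
  have hmem : ∀ ξ : K, amplify (N + 1) ρ (pullOp f c hi) (PiLp.single 2 0 ξ) ∈ corner σ := by
    intro ξ
    rw [mem_corner]
    change amplify (N + 1) ρ _ _ = _
    rw [← Representation.mul_apply]
    congr 2
    exact TranslationAlgebra.extend_one_mul (uniformlyExpansive_prod hf) hi fun a ha b =>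
      entry_pullOp_of_notMem hi ha b
  obtain ⟨η₀, hη₀, η₁, hη₁, hη⟩ := (constantVectors π).exists_add_mem_mem_orthogonal ⟨_, hmem ξ⟩
  obtain ⟨ζ, hζ, hζη⟩ := exists_mem_constantVectors_pullOp hf hg hfg hgf hi ρ hη₀
  -- after subtraction of an invariant vector, the pull-back is orthogonal to the invariant vectors
  have hη₁' : (η₁ : PiLp 2 fun _ : Fin (N + 1) => K) =
      amplify (N + 1) ρ (pullOp f c hi) (PiLp.single 2 0 (ξ - ζ)) := by
    rw [PiLp.single_sub, map_sub, hζη, eq_sub_iff_add_eq']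
    exact (congrArg Subtype.val hη).symm
  have hnorm : ‖ξ‖ ≤ ‖ξ - ζ‖ := by
    have h0 : ⟪ξ, ζ⟫_ℂ = 0 := Submodule.inner_left_of_mem_orthogonal hζ hξ
    refine abs_le_of_sq_le_sq' ?_ (norm_nonneg _) |>.2
    rw [norm_sub_sq (𝕜 := ℂ), h0]
    simp
  have hinv : AlmostInvariant ρ E (b * ‖ξ - ζ‖) (ξ - ζ) := fun t ht => by
    rw [map_sub, mem_constantVectors_iff.1 hζ t, sub_zero]
    exact (hcon t ht).le.trans (mul_le_mul_of_nonneg_left hnorm hb.le)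
  obtain ⟨t, ht, hat⟩ := hX _ π η₁ hη₁
  have h1 := hup K ρ _ _ hinv t ht
  have h2 := hlow K ρ _ _ hinv
  rw [← hη₁'] at h1 h2
  have h3 : a * ‖η₁‖ ≤ μ * (b * ‖ξ - ζ‖) := hat.trans h1
  change ‖ξ - ζ‖ ≤ κ * (b * ‖ξ - ζ‖) + R * ‖η₁‖ at h2
  have hpos : 0 < ‖ξ - ζ‖ := hξ0.trans_le hnorm
  have h4 : ‖ξ - ζ‖ ≤ 2 * (R * ‖η₁‖) := by
    have : κ * b * ‖ξ - ζ‖ ≤ 1 / 2 * ‖ξ - ζ‖ := by gcongr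
    linarith
  have h5 : a * ‖η₁‖ ≤ a / 2 * ‖η₁‖ := by
    refine h3.trans ?_
    calc μ * (b * ‖ξ - ζ‖) ≤ μ * (b * (2 * (R * ‖η₁‖))) := by gcongr
      _ = 2 * μ * R * b * ‖η₁‖ := by ring
      _ ≤ _ := by gcongr
  have h6 : ‖η₁‖ = 0 := by
    have := norm_nonneg η₁
    by_contra hne
    have : 0 < ‖η₁‖ := lt_of_le_of_ne this (Ne.symm hne)
    nlinarith
  rw [h6] at h4
  linarith

end CoarseGeometry

end

theorem mainTheorem1 (X : Type u) (Y : Type v)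
    [CoarseGeometry.CoarseSpace X] [CoarseGeometry.BoundedGeometry X]
    [CoarseGeometry.Monogenic X] [CoarseGeometry.CountablyManyComponents X]
    [CoarseGeometry.CoarseSpace Y] [CoarseGeometry.BoundedGeometry Y]
    [CoarseGeometry.Monogenic Y] [CoarseGeometry.CountablyManyComponents Y]
    (h : CoarseGeometry.CoarselyEquivalent X Y) :
    CoarseGeometry.GeometricPropertyT.{u, w} X ↔ CoarseGeometry.GeometricPropertyT.{v, w} Y :=
  ⟨.of_coarselyEquivalent h, .of_coarselyEquivalent h.symm⟩
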